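/- **Setting.** A market consists of finite sets $D$ (doctors), $H$ (hospitals) and $X\neq\emptyset$ (contracts), where each contract $x\in X$ has a doctor $x_D\in D$, a hospital $x_H\in H$, a size $s(x)\ge 0$ and a utility $u(x)\ge 0$, and of a strict total order $\succ_d$ on $X_d\cup\{\emptyset\}$ for every $d\in D$. Here $\emptyset$ is the null contract, and for $A\subseteq X$ we write $A_d=\{x\in A: x_D=d\}$, $A_h=\{x\in A: x_H=h\}$, $s(A)=\sum_{x\in A}s(x)$, $u(A)=\sum_{x\in A}u(x)$. The contracts are indexed, i.e. $X$ carries a fixed linear order. Let $\overline s=\max_{x\in X}s(x)$, and assume $\overline s<1$ and $|D|\ge 2$. Put $\gamma=\left\lceil\frac{1+\ln(|D|-1)}{1-\overline s}\right\rceil$. A set $A\subseteq X$ is a *matching* if $|A_d|\le 1$ for all $d\in D$ and $s(A_h)\le 1$ for all $h\in H$. A matching $A$ is *$\alpha$-stable* if there are no $h\in H$ and no matching $B\subseteq X_h$ such that $u(B)>\alpha\, u(A_h)$ and every $x\in B\setminus A$ is strictly preferred by $x_D$ to her contract in $A$ (to $\emptyset$ if $A_{x_D}=\emptyset$). *Greedy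 choice functions.* For $h\in H$ let $\mathcal F_h$ be the family of all $Y\subseteq X_h$ with $|\{x\in Y: s(x)>\frac1{t\gamma}\}|\le t$ for $t=1,\dots,|D|$. For a sequence of distinct contracts of $X_h$ define $\mathrm{Ch}_h()=\emptyset$ and, with $Y=\mathrm{Ch}_h(x_1,\dots,x_{k-1})\cup\{x_k\}$: $\mathrm{Ch}_h(x_1,\dots,x_k)=Y$ if $Y\in\mathcal F_h$, and $\mathrm{Ch}_h(x_1,\dots,x_k)=Y\setminus\{a\}$ otherwise, where $a$ minimizes $u$ over $\{x\in Y: Y\setminus\{x\}\in\mathcal F_h\}$ (among several minimizers, $a$ is the one of smallest index). *Generalized deferred acceptance (DA).* Start with the set of held contracts $X'=\emptyset$, the set of proposed contracts $R=\emptyset$, and an empty sequence $\boldsymbol a^h$ for each $h\in H$. As long as some doctor $d$ has $X'_d=\emptyset$ and an acceptable contract (one preferred to $\emptyset$) in $X_d\setminus R$, pick such a $d$ arbitrarily, let $x$ be her most preferred contract in $X_d\setminus R$, append $x$ to $\boldsymbol a^{x_H}$, replace $X'$ by $\mathrm{Ch}_{x_H}(\boldsymbol a^{x_H})\cup\bigcup_{h\ne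 x_H}X'_h$, and add $x$ to $R$. When there is no such doctor, return $X'$. **Theorem.** For every such market, generalized DA with the greedy choice functions always terminates, whichever doctors are picked, and 1. it is strategy-proof for doctors: if only doctor $d$ changes her report from her true preference $\succ_d$ to another one, then, whichever doctors are picked in the two runs, the outcome for $d$ of the second run is not strictly preferred under $\succ_d$ to the outcome for $d$ of the first run; 2. every output is a $\left\lceil\frac{1+\ln(|D|-1)}{1-\overline s}\right\rceil$-stable matching. Moreover, the mechanism can be implemented to run in $O(|X|^2)$ time: there are a single program of a unit-cost random access machine over the natural and real numbers (with the real operations $+,-,\times,/,<,\ln,\lceil\cdot\rceil$) and a constant $c$ such that on every market as above the program halts after at most $c\,|X|^2$ steps and outputs a set $X'$ that generalized DA with the greedy choice functions returns. The input consists of the numbers $|D|,|H|,|X|$ and, for every contract $x$, of $x_D$, $x_H$, $s(x)$, $u(x)$ and the position of $x$ on the list of acceptable contracts of $x_D$, ordered by preference ($0$ if $x$ is unacceptable). -/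

import Mathlib

universe u v w

/-- The preference-free part of a matching market with contracts: every contract `x` names a doctor
and a hospital, and carries a nonnegative size (the fraction of the hospital's budget that is paid
as a wage) and a nonnegative utility (for its hospital). -/
structure Market (D : Type u) (H : Type v) (X : Type w) where
  doc : X → D
  hosp : X → H
  size : X → ℝ
  util : X → ℝ
  size_nonneg : ∀ x, 0 ≤ size x
  util_nonneg : ∀ x, 0 ≤ util x

namespace Market

section Basic

variable {D : Type u} {H : Type v} {X : Type w}

/-- The contracts of doctor `d`. -/
abbrev Contr (M : Market D H X) (d : D) : Type w := {x : X // M.doc x = d}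

/-- A profile of doctors' preferences: for every doctor `d` a strict total order on `X_d ∪ {∅}`,
where `none` is the null contract; `P.pref d a b` says that `d` strictly prefers `a` to `b`. -/
structure Profile (M : Market D H X) where
  pref : ∀ d : D, Option (M.Contr d) → Option (M.Contr d) → Prop
  strict_total : ∀ d : D, IsStrictTotalOrder (Option (M.Contr d)) (pref d)

/-- `o` is what doctor `d` gets under the set of contracts `A`: one of her contracts in `A`, or the
null contract if she has none. -/
def Assigned (M : Market D H X) (A : Finset X) (d : D) : Option (M.Contr d) → Prop
  | none => ∀ x ∈ A, M.doc x ≠ d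
  | some x => x.1 ∈ A

end Basic

section Stability

variable {D : Type u} {H : Type v} {X : Type w} [DecidableEq D] [DecidableEq H]

/-- `A_d`. -/
def ofDoctor (M : Market D H X) (A : Finset X) (d : D) : Finset X :=
  A.filter (fun x => M.doc x = d)

/-- `A_h`. -/
def ofHospital (M : Market D H X) (A : Finset X) (h : H) : Finset X :=
  A.filter (fun x => M.hosp x = h)

def totalSize (M : Market D H X) (A : Finset X) : ℝ := ∑ x ∈ A, M.size x

def totalUtil (M : Market D H X) (A : Finset X) : ℝ := ∑ x ∈ A, M.util x

/-- Every doctor signs at most one contract and every hospital respects its (unit) budget. -/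
def IsMatching (M : Market D H X) (A : Finset X) : Prop :=
  (∀ d, (M.ofDoctor A d).card ≤ 1) ∧ (∀ h, M.totalSize (M.ofHospital A h) ≤ 1)

/-- The matching `B ⊆ X_h` is an `α`-blocking coalition for `A` and the hospital `h`. -/
def IsBlocking (M : Market D H X) (P : M.Profile) (α : ℝ) (A : Finset X) (h : H) (B : Finset X) :
    Prop :=
  M.IsMatching B ∧ (∀ x ∈ B, M.hosp x = h) ∧
  (∀ x ∈ B, x ∉ A → ∀ o, M.Assigned A (M.doc x) o → P.pref (M.doc x) (some ⟨x, rfl⟩) o) ∧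
  α * M.totalUtil (M.ofHospital A h) < M.totalUtil B

/-- `A` is an `α`-stable matching. -/
def IsStable (M : Market D H X) (P : M.Profile) (α : ℝ) (A : Finset X) : Prop :=
  M.IsMatching A ∧ ¬ ∃ (h : H) (B : Finset X), M.IsBlocking P α A h B

end Stability

section GeneralizedDA

variable {D : Type u} {H : Type v} {X : Type w} [DecidableEq D] [DecidableEq H]
  [Fintype X] [DecidableEq X]

open Classical in
/-- The choice of doctor `d` from a set `A` of contracts: her most preferred contract in `A_d`
(as a singleton) if it is acceptable, and the empty set otherwise. -/
noncomputable def doctorChoice (M : Market D H X) (P : M.Profile) (d : D) (A : Finset X) :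
    Finset X :=
  A.filter (fun x => ∃ hx : M.doc x = d, P.pref d (some ⟨x, hx⟩) none ∧
    ∀ y ∈ A, ∀ hy : M.doc y = d, y ≠ x → P.pref d (some ⟨x, hx⟩) (some ⟨y, hy⟩))

/-- The variables of the generalized deferred acceptance procedure: the sequences of proposed
contracts, the contracts currently held, and the contracts proposed so far. -/
structure DAState (H : Type v) (X : Type w) where
  seq : H → List X
  held : Finset X
  proposed : Finset X

/-- The initial values of the variables. -/
def daStart : DAState H X := ⟨fun _ => [], ∅, ∅⟩

/-- `Ch_d (X_d \ R_d)`. -/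
noncomputable def nextProposal (M : Market D H X) (P : M.Profile) (S : DAState H X) (d : D) :
    Finset X :=
  M.doctorChoice P d (M.ofDoctor Finset.univ d \ M.ofDoctor S.proposed d)

/-- Doctor `d` is unmatched and has an acceptable contract that she has not proposed yet. -/
def IsActive (M : Market D H X) (P : M.Profile) (S : DAState H X) (d : D) : Prop :=
  M.ofDoctor S.held d = ∅ ∧ M.nextProposal P S d ≠ ∅

/-- One iteration of generalized deferred acceptance with the sequential choice functions `Ch`:
some active doctor, picked arbitrarily, makes her next proposal. -/
def DAStep (M : Market D H X) (Ch : H → List X → Finset X) (P : M.Profile)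
    (S T : DAState H X) : Prop :=
  ∃ (d : D) (x : X), M.IsActive P S d ∧ M.nextProposal P S d = {x} ∧
    T.seq = Function.update S.seq (M.hosp x) (S.seq (M.hosp x) ++ [x]) ∧
    T.held = Ch (M.hosp x) (T.seq (M.hosp x)) ∪ S.held.filter (fun y => M.hosp y ≠ M.hosp x) ∧
    T.proposed = insert x S.proposed

/-- Whatever doctors are picked, generalized deferred acceptance comes to an end. -/
def DATerminates (M : Market D H X) (Ch : H → List X → Finset X) (P : M.Profile) : Prop :=
  ¬ ∃ r : ℕ → DAState H X, r 0 = daStart ∧ ∀ i, M.DAStep Ch P (r i) (r (i + 1))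

/-- `A` is returned by some run of generalized deferred acceptance. -/
def DAOutcome (M : Market D H X) (Ch : H → List X → Finset X) (P : M.Profile) (A : Finset X) :
    Prop :=
  ∃ S : DAState H X, Relation.ReflTransGen (M.DAStep Ch P) daStart S ∧
    (∀ d, ¬ M.IsActive P S d) ∧ S.held = A

/-- Strategy-proofness for doctors: if only doctor `d` changes her report, from her true preference
(that of `P`) to any other one, she does not get anything that she strictly prefers, whatever
doctors are picked during the two runs. -/
def StrategyProof (M : Market D H X) (Ch : H → List X → Finset X) : Prop :=
  ∀ (P Q : M.Profile) (d : D), (∀ e, e ≠ d → Q.pref e = P.pref e) →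
    ∀ A B : Finset X, M.DAOutcome Ch P A → M.DAOutcome Ch Q B →
      ∀ a b, M.Assigned A d a → M.Assigned B d b → ¬ P.pref d b a

end GeneralizedDA

section GreedyChoice

variable {D : Type u} {H : Type v} {X : Type w} [Fintype D] [DecidableEq H]
  [Fintype X] [LinearOrder X]

/-- The largest size of a contract (there are finitely many contracts, and at least one whenever
this is used). -/
noncomputable def maxSize (M : Market D H X) : ℝ := ⨆ x, M.size x

/-- `γ = ⌈(1 + ln (|D| - 1)) / (1 - s̄)⌉`. -/
noncomputable def gamma (M : Market D H X) : ℤ :=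
  ⌈(1 + Real.log ((Fintype.card D : ℝ) - 1)) / (1 - M.maxSize)⌉

open Classical in
/-- The independent sets of the transversal matroid of the hospital `h`. -/
def IsIndep (M : Market D H X) (h : H) (Y : Finset X) : Prop :=
  (∀ x ∈ Y, M.hosp x = h) ∧
  ∀ t : ℕ, 1 ≤ t → t ≤ Fintype.card D →
    (Y.filter (fun x => 1 / ((t : ℝ) * (M.gamma : ℝ)) < M.size x)).card ≤ t

/-- `a` is the minimizer of the utility among those `x ∈ Y` for which `Y \ {x}` is independent;
ties are broken in favour of the smallest index. -/
def IsDiscarded (M : Market D H X) (h : H) (Y : Finset X) (a : X) : Prop :=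
  a ∈ Y ∧ M.IsIndep h (Y.erase a) ∧
  ∀ b ∈ Y, M.IsIndep h (Y.erase b) → M.util a < M.util b ∨ (M.util a = M.util b ∧ a ≤ b)

open Classical in
/-- The treatment of one further contract `x` when `Y` is the choice so far. -/
noncomputable def greedyStep (M : Market D H X) (h : H) (Y : Finset X) (x : X) : Finset X :=
  if M.IsIndep h (insert x Y) then insert x Y
  else (insert x Y).filter (fun a => ¬ M.IsDiscarded h (insert x Y) a)

/-- The greedy sequential choice function of the hospital `h`: it processes the contracts of the
sequence one by one, starting from the empty set. -/
noncomputable def greedyChoice (M : Market D H X) (h : H) (l : List X) : Finset X :=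
  l.foldl (M.greedyStep h) ∅

end GreedyChoice

end Market

/-! A random access machine over the natural and the real numbers, programmed in a structured
language, with unit costs. It has registers and arrays for natural numbers, and registers and
arrays for real numbers. Array cells are addressed by the contents of natural number registers. -/

namespace RealRAM

structure Store where
  nat : ℕ → ℕ
  real : ℕ → ℝ
  natArr : ℕ → ℕ → ℕ
  realArr : ℕ → ℕ → ℝ

/-- The elementary instructions. The first argument names the register (or array) that changes. -/
inductive Instr : Type
  | const (i c : ℕ)
  | move (i j : ℕ)
  | add (i j k : ℕ)
  | sub (i j k : ℕ)
  | load (i a j : ℕ)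
  | put (a j i : ℕ)
  | rcast (i j : ℕ)
  | rmove (i j : ℕ)
  | radd (i j k : ℕ)
  | rsub (i j k : ℕ)
  | rmul (i j k : ℕ)
  | rdiv (i j k : ℕ)
  | rlog (i j : ℕ)
  | rceil (i j : ℕ)
  | rload (i a j : ℕ)
  | rput (a j i : ℕ)

def Store.setNat (σ : Store) (i v : ℕ) : Store :=
  { σ with nat := Function.update σ.nat i v }

noncomputable def Store.setReal (σ : Store) (i : ℕ) (v : ℝ) : Store :=
  { σ with real := Function.update σ.real i v }

def Store.setNatArr (σ : Store) (a j v : ℕ) : Store :=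
  { σ with natArr := Function.update σ.natArr a (Function.update (σ.natArr a) j v) }

noncomputable def Store.setRealArr (σ : Store) (a j : ℕ) (v : ℝ) : Store :=
  { σ with realArr := Function.update σ.realArr a (Function.update (σ.realArr a) j v) }

/-- The effect of an elementary instruction. -/
noncomputable def Instr.apply : Instr → Store → Store
  | .const i c, σ => σ.setNat i c
  | .move i j, σ => σ.setNat i (σ.nat j)
  | .add i j k, σ => σ.setNat i (σ.nat j + σ.nat k)
  | .sub i j k, σ => σ.setNat i (σ.nat j - σ.nat k)
  | .load i a j, σ => σ.setNat i (σ.natArr a (σ.nat j))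
  | .put a j i, σ => σ.setNatArr a (σ.nat j) (σ.nat i)
  | .rcast i j, σ => σ.setReal i (σ.nat j : ℝ)
  | .rmove i j, σ => σ.setReal i (σ.real j)
  | .radd i j k, σ => σ.setReal i (σ.real j + σ.real k)
  | .rsub i j k, σ => σ.setReal i (σ.real j - σ.real k)
  | .rmul i j k, σ => σ.setReal i (σ.real j * σ.real k)
  | .rdiv i j k, σ => σ.setReal i (σ.real j / σ.real k)
  | .rlog i j, σ => σ.setReal i (Real.log (σ.real j))
  | .rceil i j, σ => σ.setReal i (⌈σ.real j⌉ : ℝ)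
  | .rload i a j, σ => σ.setReal i (σ.realArr a (σ.nat j))
  | .rput a j i, σ => σ.setRealArr a (σ.nat j) (σ.real i)

/-- The tests: comparisons of two registers. -/
inductive Test : Type
  | eq (i j : ℕ)
  | lt (i j : ℕ)
  | rlt (i j : ℕ)

def Test.Holds : Test → Store → Prop
  | .eq i j, σ => σ.nat i = σ.nat j
  | .lt i j, σ => σ.nat i < σ.nat j
  | .rlt i j, σ => σ.real i < σ.real j

/-- Programs: finite texts, built from elementary instructions by sequencing, branching and
loops. -/
inductive Prog : Type
  | skip
  | instr (c : Instr)
  | seq (p q : Prog)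
  | ite (b : Test) (p q : Prog)
  | loop (b : Test) (p : Prog)

/-- `Exec p σ τ n`: started in `σ`, the program `p` halts in `τ` after `n` steps. Every elementary
instruction and every evaluation of a test is one step. -/
inductive Exec : Prog → Store → Store → ℕ → Prop
  | skip (σ : Store) : Exec .skip σ σ 1
  | instr (c : Instr) (σ : Store) : Exec (.instr c) σ (c.apply σ) 1
  | seq {p q : Prog} {σ τ ρ : Store} {m n : ℕ} (hp : Exec p σ τ m) (hq : Exec q τ ρ n) :
      Exec (.seq p q) σ ρ (m + n)
  | ite_true {b : Test} {p q : Prog} {σ τ : Store} {n : ℕ} (hb : b.Holds σ) (hp : Exec p σ τ n) :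
      Exec (.ite b p q) σ τ (n + 1)
  | ite_false {b : Test} {p q : Prog} {σ τ : Store} {n : ℕ} (hb : ¬ b.Holds σ)
      (hq : Exec q σ τ n) : Exec (.ite b p q) σ τ (n + 1)
  | loop_done {b : Test} {p : Prog} {σ : Store} (hb : ¬ b.Holds σ) : Exec (.loop b p) σ σ 1
  | loop_next {b : Test} {p : Prog} {σ τ ρ : Store} {m n : ℕ} (hb : b.Holds σ)
      (hp : Exec p σ τ m) (hl : Exec (.loop b p) τ ρ n) : Exec (.loop b p) σ ρ (m + n + 1)

end RealRAM

namespace Market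

open Classical in
/-- The position (1, 2, …) of the contract `x` on its doctor's list of acceptable contracts, best
first; 0 if `x` is unacceptable. -/
noncomputable def listPosition {D : Type u} {H : Type v} {X : Type w} [Fintype X]
    (M : Market D H X) (P : M.Profile) (x : X) : ℕ :=
  if P.pref (M.doc x) (some ⟨x, rfl⟩) none then
    1 + (Finset.univ.filter (fun y : X => ∃ hy : M.doc y = M.doc x,
      P.pref (M.doc x) (some ⟨y, hy⟩) (some ⟨x, rfl⟩))).card
  else 0

/-- The input of the machine: the numbers of doctors, hospitals and contracts in the first three
natural number registers; the doctors, hospitals and list positions of the contracts in the first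
three natural number arrays; their sizes and utilities in the first two real number arrays.
Everything else is 0. -/
noncomputable def input {n k m : ℕ} (M : Market (Fin n) (Fin k) (Fin m)) (P : M.Profile) :
    RealRAM.Store where
  nat := fun i => if i = 0 then n else if i = 1 then k else if i = 2 then m else 0
  real := fun _ => 0
  natArr := fun a j => if hj : j < m then
      (if a = 0 then (M.doc ⟨j, hj⟩ : ℕ) else if a = 1 then (M.hosp ⟨j, hj⟩ : ℕ)
        else if a = 2 then M.listPosition P ⟨j, hj⟩ else 0)
    else 0
  realArr := fun a j => if hj : j < m then
      (if a = 0 then M.size ⟨j, hj⟩ else if a = 1 then M.util ⟨j, hj⟩ else 0)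
    else 0

/-- The fourth natural number array holds the indicator function of the set `A` of contracts. -/
def IsOutput {m : ℕ} (σ : RealRAM.Store) (A : Finset (Fin m)) : Prop :=
  ∀ x : Fin m, σ.natArr 3 (x : ℕ) = if x ∈ A then 1 else 0

end Market

/-!
For every hospital, the admissible families of contracts are the independent sets of a matroid:
the contracts that are large at level `t` become more numerous with `t`, and at most `t` of them are
allowed. The greedy choice function therefore keeps the heaviest basis of the proposals received
(`Market.greedyChoice_eq`), where ties in utility are broken by index. Since the heaviest basis
consists of the elements that are not spanned by better ones, the choice depends only on the set of
proposals, is substitutable, and obeys the law of aggregate demand.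

Substitutability makes "proposed because everything better was proposed and rejected" a monotone
condition, and the set of all proposals made in a run is its least fixed point, whatever doctors are
picked (`Market.DAOutcome.exists_isLeastClosed`). Strategy-proofness is an argument on such
least fixed points (`PrefLists.IsLeastClosed.not_mem_rejected`): if a misreport led a doctor to a
contract `b` that she loses when truthful, then she would be matched when reporting `b` alone and
unmatched when cutting her true list below `b`. The proposals of the first case are among those of
the second one, but everybody matched in the second case is matched in the first one as well; this
contradicts the law of aggregate demand.

For stability, order a set of contracts by decreasing size. In an independent set, the contract at
position `t ≥ 1` has size at most `1 / (t γ)`, so that the harmonic sum bounds the total size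
(`Market.IsIndep.totalSize_le_one`). Conversely, a set within the budget has at most `t γ` contracts
that are large at level `t`, so that dealing it out in turn to `γ` classes yields independent sets,
each of which has at most the utility of the heaviest basis (`Market.totalUtil_le_gamma_mul`). A
blocking coalition has been proposed in full, so it cannot exceed `γ` times the utility held.

For the running time, the level of every contract, the first one at which it is large, is tabulated
in advance. Then every proposal takes linear time: the contracts held are counted by level, the
first violated bound is found by a scan over the levels, and the contract to be discarded is the
worst one among those that are large there (`Market.isIndep_erase_iff`). Only the levels up to
`min |D| |X|` matter. Programs are verified by `RealRAM.Spec`, which bounds the number of steps and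
describes the final store; that a program leaves everything else unchanged is read off its text
(`RealRAM.Exec.frame`).
-/

/-! ### Deferred acceptance as a least fixed point -/

/-- The preference lists of doctors with a single unit of demand: `acc x` says that the contract
`x` is acceptable to its doctor, `better y x` that `y` and `x` are contracts of the same doctor and
that she strictly prefers `y`. -/
structure PrefLists {D X : Type*} (doc : X → D) where
  acc : X → Prop
  better : X → X → Prop
  doc_eq : ∀ {y x}, better y x → doc y = doc x
  irrefl : ∀ x, ¬ better x x
  trans : ∀ {z y x}, better z y → better y x → better z x
  acc_of_better : ∀ {y x}, better y x → acc x → acc y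
  total : ∀ {y x}, doc y = doc x → y ≠ x → acc y → acc x → better y x ∨ better x y

namespace PrefLists

variable {D X : Type*} {doc : X → D}

/-- The lists from which every contract outside of `p` has been deleted. -/
def restrict (L : PrefLists doc) (p : X → Prop) : PrefLists doc where
  acc x := L.acc x ∧ p x
  better y x := L.better y x ∧ p y
  doc_eq h := L.doc_eq h.1
  irrefl x h := L.irrefl x h.1
  trans h₁ h₂ := ⟨L.trans h₁.1 h₂.1, h₁.2⟩
  acc_of_better h₁ h₂ := ⟨L.acc_of_better h₁.1 h₂.1, h₁.2⟩
  total h hne hy hx := (L.total h hne hy.1 hx.1).imp (⟨·, hy.2⟩) (⟨·, hx.2⟩)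

/-- The set `S` of proposals is closed if it contains every acceptable contract such that all
contracts that its doctor prefers to it have been proposed and rejected. -/
def IsClosed [DecidableEq X] (L : PrefLists doc) (C : Finset X → Finset X) (S : Finset X) : Prop :=
  ∀ x, L.acc x → (∀ y, L.better y x → y ∈ S \ C S) → x ∈ S

/-- `R` is the least closed set of proposals, which is the set of all proposals made during
deferred acceptance. -/
def IsLeastClosed [DecidableEq X] (L : PrefLists doc) (C : Finset X → Finset X) (R : Finset X) :
    Prop :=
  L.IsClosed C R ∧ ∀ S, L.IsClosed C S → R ⊆ S

variable [DecidableEq X] {C : Finset X → Finset X}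

/-- For a substitutable choice function `C` the rejections `S \ C S` grow with `S`. -/
theorem sdiff_choice_mono (hsub : ∀ ⦃R S : Finset X⦄, R ⊆ S → C S ∩ R ⊆ C R)
    {R S : Finset X} (h : R ⊆ S) : R \ C R ⊆ S \ C S := by
  intro x hx
  rw [Finset.mem_sdiff] at hx ⊢
  exact ⟨h hx.1, fun hc => hx.2 (hsub h (Finset.mem_inter.2 ⟨hc, hx.1⟩))⟩

theorem exists_isLeastClosed [Fintype X] (L : PrefLists doc)
    (hsub : ∀ ⦃R S : Finset X⦄, R ⊆ S → C S ∩ R ⊆ C R) : ∃ R, L.IsLeastClosed C R := by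
  classical
  have hle : ∀ S, L.IsClosed C S →
      Finset.univ.filter (fun x => ∀ S, L.IsClosed C S → x ∈ S) ⊆ S :=
    fun S hS x hx => (Finset.mem_filter.1 hx).2 S hS
  refine ⟨Finset.univ.filter (fun x => ∀ S, L.IsClosed C S → x ∈ S), fun x hx hy => ?_, hle⟩
  exact Finset.mem_filter.2 ⟨Finset.mem_univ _, fun S hS =>
    hS x hx fun y hyx => sdiff_choice_mono hsub (hle S hS) (hy y hyx)⟩

/-- The least closed set contains nothing but what closedness forces: it is a fixed point. -/
theorem IsLeastClosed.acc_and_rejected {L : PrefLists doc} {R : Finset X}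
    (hR : L.IsLeastClosed C R) (hsub : ∀ ⦃R S : Finset X⦄, R ⊆ S → C S ∩ R ⊆ C R)
    {x : X} (hx : x ∈ R) : L.acc x ∧ ∀ y, L.better y x → y ∈ R \ C R := by
  classical
  have hle : R.filter (fun x => L.acc x ∧ ∀ y, L.better y x → y ∈ R \ C R) ⊆ R :=
    Finset.filter_subset _ _
  refine (Finset.mem_filter.1 (hR.2 (R.filter fun x => L.acc x ∧ ∀ y, L.better y x → y ∈ R \ C R)
    (fun z hz hy => ?_) hx)).2
  have hy' := fun y hyz => sdiff_choice_mono hsub hle (hy y hyz)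
  exact Finset.mem_filter.2 ⟨hR.1 z hz hy', hz, hy'⟩

/-- Every acceptable contract is proposed unless its doctor holds a better one. -/
theorem IsClosed.mem [Finite X] {L : PrefLists doc} {R : Finset X} (hR : L.IsClosed C R) {x : X}
    (hx : L.acc x) (h : ∀ y ∈ C R, ¬ L.better y x) : x ∈ R := by
  have : IsTrans X L.better := ⟨fun _ _ _ => L.trans⟩
  have : Std.Irrefl L.better := ⟨L.irrefl⟩
  induction x using (Finite.wellFounded_of_trans_of_irrefl L.better).induction with
  | _ x ih =>
    refine hR x hx fun y hy => Finset.mem_sdiff.2 ⟨?_, fun hc => h y hc hy⟩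
    exact ih y hy (L.acc_of_better hy hx) fun z hz hzy => h z hz (L.trans hzy hy)

theorem IsLeastClosed.injOn {L : PrefLists doc} {R : Finset X}
    (hR : L.IsLeastClosed C R) (hC : ∀ S, C S ⊆ S)
    (hsub : ∀ ⦃R S : Finset X⦄, R ⊆ S → C S ∩ R ⊆ C R) : Set.InjOn doc (C R : Set X) := by
  intro x hx y hy hxy
  by_contra hne
  have hx' := hR.acc_and_rejected hsub (hC _ hx)
  have hy' := hR.acc_and_rejected hsub (hC _ hy)
  rcases L.total hxy hne hx'.1 hy'.1 with h | h
  · exact (Finset.mem_sdiff.1 (hy'.2 x h)).2 hx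
  · exact (Finset.mem_sdiff.1 (hx'.2 y h)).2 hy

/-- A contract that doctor `d` obtains by some report is not rejected when she reports truthfully.
Otherwise, she would end up unmatched after cutting her true list below `b`, but she would be
matched after reporting `b` alone, which is a smaller set of proposals overall. As no other doctor
that is matched in the first case is unmatched in the second one, this contradicts the law of
aggregate demand. -/
theorem IsLeastClosed.not_mem_rejected [Fintype X] {L L' : PrefLists doc} {R R' : Finset X} {b : X}
    (hR : L.IsLeastClosed C R) (hR' : L'.IsLeastClosed C R')
    (hC : ∀ S, C S ⊆ S) (hsub : ∀ ⦃R S : Finset X⦄, R ⊆ S → C S ∩ R ⊆ C R)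
    (hcard : ∀ ⦃R S : Finset X⦄, R ⊆ S → (C R).card ≤ (C S).card)
    (hacc : ∀ x, doc x ≠ doc b → (L.acc x ↔ L'.acc x))
    (hbetter : ∀ y x, doc x ≠ doc b → (L.better y x ↔ L'.better y x))
    (hb : b ∈ C R') : b ∉ R \ C R := by
  classical
  intro hbR
  have hbacc : L.acc b := (hR.acc_and_rejected hsub (Finset.mem_sdiff.1 hbR).1).1
  -- `U` are the proposals if the list is cut below `b`, and `V` those if it consists of `b` only.
  obtain ⟨U, hU⟩ := (L.restrict fun x => doc x = doc b → x = b ∨ L.better x b).exists_isLeastClosed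
    hsub
  obtain ⟨V, hV⟩ := (L.restrict fun x => doc x = doc b → x = b).exists_isLeastClosed hsub
  have hbU : b ∈ U \ C U := by
    by_contra hcon
    refine hcon (sdiff_choice_mono hsub (hR.2 U fun x hx hy => ?_) hbR)
    refine hU.1 x ⟨hx, fun hd => ?_⟩ fun y hyx => hy y hyx.1
    by_contra hn
    push Not at hn
    rcases L.total hd hn.1 hx hbacc with h | h
    · exact hn.2 h
    · exact hcon (hy b h)
  have hbV : b ∈ C V := by
    have hVR' : V ⊆ R' := hV.2 R' fun x hx hy => by
      by_cases hd : doc x = doc b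
      · rw [hx.2 hd]
        exact hC _ hb
      · refine hR'.1 x ((hacc x hd).1 hx.1) fun y hyx => hy y ⟨(hbetter y x hd).2 hyx, fun h => ?_⟩
        exact absurd ((L'.doc_eq hyx).symm.trans h) hd
    have : b ∈ V := hV.1 b ⟨hbacc, fun _ => rfl⟩ fun y hy =>
      absurd hy.1 (by rw [hy.2 (L.doc_eq hy.1)]; exact L.irrefl b)
    exact hsub hVR' (Finset.mem_inter.2 ⟨hb, this⟩)
  have hVU : V ⊆ U := hV.2 U fun x hx hy => by
    by_cases hd : doc x = doc b
    · rw [hx.2 hd]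
      exact (Finset.mem_sdiff.1 hbU).1
    · refine hU.1 x ⟨hx.1, fun h => absurd h hd⟩ fun y hyx => hy y ⟨hyx.1, fun h => ?_⟩
      exact absurd ((L.doc_eq hyx.1).symm.trans h) hd
  have hlt : ((C U).image doc).card < ((C V).image doc).card := by
    refine Finset.card_lt_card ((Finset.ssubset_iff_of_subset fun e he => ?_).2
      ⟨doc b, Finset.mem_image_of_mem _ hbV, fun hd => ?_⟩)
    · obtain ⟨z, hz, rfl⟩ := Finset.mem_image.1 he
      by_contra hn
      have hzb : doc z ≠ doc b := fun h => hn (h ▸ Finset.mem_image_of_mem _ hbV)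
      have hzV : z ∈ V := hV.1.mem
        ⟨(hU.acc_and_rejected hsub (hC _ hz)).1.1, fun h => absurd h hzb⟩
        fun y hy hyz => hn (L.doc_eq hyz.1 ▸ Finset.mem_image_of_mem _ hy)
      exact hn (Finset.mem_image_of_mem _ (hsub hVU (Finset.mem_inter.2 ⟨hz, hzV⟩)))
    · obtain ⟨z, hz, hzd⟩ := Finset.mem_image.1 hd
      rcases (hU.acc_and_rejected hsub (hC _ hz)).1.2 hzd with rfl | h
      · exact (Finset.mem_sdiff.1 hbU).2 hz
      · exact (Finset.mem_sdiff.1 ((hU.acc_and_rejected hsub (Finset.mem_sdiff.1 hbU).1).2 z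
          ⟨h, fun _ => Or.inr h⟩)).2 hz
  rw [Finset.card_image_of_injOn (hU.injOn hC hsub)] at hlt
  exact absurd (hcard hVU) (not_le.2 (hlt.trans_le Finset.card_image_le))

end PrefLists

/-! ### The heaviest basis of a matroid -/

namespace Matroid

variable {X κ : Type*} [LinearOrder κ]

open Classical in
/-- The heaviest basis of `S` for the priorities `p`, as found by the greedy algorithm: the elements
that are not spanned by the elements of `S` of higher priority. -/
noncomputable def heaviestBasis (N : Matroid X) (p : X → κ) (S : Finset X) : Finset X :=
  S.filter fun x => x ∉ N.closure {y | y ∈ S ∧ p x < p y}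

theorem mem_heaviestBasis {N : Matroid X} {p : X → κ} {S : Finset X} {x : X} :
    x ∈ N.heaviestBasis p S ↔ x ∈ S ∧ x ∉ N.closure {y | y ∈ S ∧ p x < p y} := by
  classical exact Finset.mem_filter

theorem heaviestBasis_subset (N : Matroid X) (p : X → κ) (S : Finset X) :
    N.heaviestBasis p S ⊆ S :=
  fun _ hx => (mem_heaviestBasis.1 hx).1

variable [DecidableEq X]

/-- Substitutability: a larger set spans more. -/
theorem heaviestBasis_inter_subset (N : Matroid X) (p : X → κ) ⦃R S : Finset X⦄ (h : R ⊆ S) :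
    N.heaviestBasis p S ∩ R ⊆ N.heaviestBasis p R := by
  intro x hx
  rw [Finset.mem_inter, mem_heaviestBasis] at hx
  refine mem_heaviestBasis.2 ⟨hx.2, fun hc => hx.1.2 (N.closure_subset_closure ?_ hc)⟩
  exact fun y hy => ⟨h hy.1, hy.2⟩

variable {N : Matroid X} (hE : N.E = Set.univ) {p : X → κ} (hp : Function.Injective p)

include hE hp in
theorem isBasis_heaviestBasis (S : Finset X) :
    N.IsBasis (N.heaviestBasis p S : Set X) (S : Set X) := by
  induction S using Finset.induction_on_min_value p with
  | empty =>
    have : N.heaviestBasis p ∅ = ∅ := Finset.subset_empty.1 (N.heaviestBasis_subset p ∅)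
    simp [this]
  | insert a S ha hmin ih =>
    have hlt : ∀ x ∈ S, p a < p x := fun x hx =>
      (hmin x hx).lt_of_ne fun h => ha (hp h ▸ hx)
    -- As `a` has the lowest priority, it has no effect on the other elements.
    have hold : ∀ x ∈ S, (x ∈ N.heaviestBasis p (insert a S) ↔ x ∈ N.heaviestBasis p S) := by
      intro x hx
      have : {y | y ∈ insert a S ∧ p x < p y} = {y | y ∈ S ∧ p x < p y} := by
        ext y
        simp only [Finset.mem_insert, Set.mem_ofPred_eq]
        constructor
        · rintro ⟨rfl | h, h'⟩
          · exact absurd h' (hlt x hx).not_gt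
          · exact ⟨h, h'⟩
        · exact fun h => ⟨Or.inr h.1, h.2⟩
      rw [mem_heaviestBasis, mem_heaviestBasis, this, Finset.mem_insert]
      tauto
    have hnew : a ∈ N.heaviestBasis p (insert a S) ↔ a ∉ N.closure (S : Set X) := by
      have : {y | y ∈ insert a S ∧ p a < p y} = (S : Set X) := by
        ext y
        simp only [Finset.mem_insert, Set.mem_ofPred_eq, Finset.mem_coe]
        constructor
        · rintro ⟨rfl | h, h'⟩
          · exact absurd h' (lt_irrefl _)
          · exact h
        · exact fun h => ⟨Or.inr h, hlt y h⟩
      rw [mem_heaviestBasis, this]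
      simp
    have haB : a ∉ (N.heaviestBasis p S : Set X) :=
      fun h => ha (N.heaviestBasis_subset p S h)
    by_cases hcl : a ∈ N.closure (S : Set X)
    · have heq : N.heaviestBasis p (insert a S) = N.heaviestBasis p S := by
        ext x
        by_cases hxS : x ∈ S
        · exact hold x hxS
        · refine ⟨fun h => ?_, fun h => absurd (N.heaviestBasis_subset p S h) hxS⟩
          rcases Finset.mem_insert.1 (N.heaviestBasis_subset p _ h) with rfl | h'
          · exact absurd hcl (hnew.1 h)
          · exact absurd h' hxS
      rw [heq, Finset.coe_insert]
      refine ih.indep.isBasis_of_subset_of_subset_closure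
        (ih.subset.trans (Set.subset_insert _ _)) ?_
      rw [ih.closure_eq_closure]
      exact Set.insert_subset hcl (N.subset_closure _ (by simp [hE]))
    · have heq : N.heaviestBasis p (insert a S) = insert a (N.heaviestBasis p S) := by
        ext x
        rw [Finset.mem_insert]
        by_cases hxS : x ∈ S
        · rw [hold x hxS]
          exact ⟨Or.inr, fun h => h.resolve_left fun h => ha (h ▸ hxS)⟩
        · refine ⟨fun h => ?_, ?_⟩
          · exact Or.inl ((Finset.mem_insert.1 (N.heaviestBasis_subset p _ h)).resolve_right hxS)
          · rintro (rfl | h)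
            · exact hnew.2 hcl
            · exact absurd (N.heaviestBasis_subset p S h) hxS
      rw [heq, Finset.coe_insert, Finset.coe_insert]
      refine ih.insert_isBasis_insert ?_
      rw [← ih.closure_eq_closure] at hcl
      exact (ih.indep.notMem_closure_iff_of_notMem haB (by simp [hE])).1 hcl

include hE hp in
theorem card_le_card_heaviestBasis {I S : Finset X} (hI : N.Indep I) (hIS : I ⊆ S) :
    I.card ≤ (N.heaviestBasis p S).card := by
  obtain ⟨J, hJ, hIJ⟩ := hI.subset_isBasis_of_subset (Finset.coe_subset.2 hIS) (by simp [hE])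
  have h := hJ.isBasis'.encard_eq_encard (isBasis_heaviestBasis hE hp S).isBasis'
  have h' := Set.encard_le_encard hIJ
  rw [h] at h'
  simpa using h'

include hE hp in
/-- The law of aggregate demand: the size of a basis is the rank. -/
theorem card_heaviestBasis_mono ⦃R S : Finset X⦄ (h : R ⊆ S) :
    (N.heaviestBasis p R).card ≤ (N.heaviestBasis p S).card :=
  card_le_card_heaviestBasis hE hp (isBasis_heaviestBasis hE hp R).indep
    ((N.heaviestBasis_subset p R).trans h)

include hE hp in
/-- Independence of rejected contracts. -/
theorem heaviestBasis_eq_of_subset {R S : Finset X} (h : R ⊆ S) (h' : N.heaviestBasis p S ⊆ R) :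
    N.heaviestBasis p R = N.heaviestBasis p S := by
  have hsub := N.heaviestBasis_inter_subset p h
  rw [Finset.inter_eq_left.2 h'] at hsub
  exact (Finset.eq_of_subset_of_card_le hsub (card_heaviestBasis_mono hE hp h)).symm

include hE hp in
/-- The heaviest basis can be computed online. -/
theorem heaviestBasis_insert_heaviestBasis (S : Finset X) (x : X) :
    N.heaviestBasis p (insert x (N.heaviestBasis p S)) = N.heaviestBasis p (insert x S) := by
  refine heaviestBasis_eq_of_subset hE hp
    (Finset.insert_subset_insert _ (N.heaviestBasis_subset p S)) fun z hz => ?_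
  rcases Finset.mem_insert.1 (N.heaviestBasis_subset p _ hz) with rfl | h
  · exact Finset.mem_insert_self _ _
  · exact Finset.mem_insert_of_mem
      (N.heaviestBasis_inter_subset p (Finset.subset_insert x S) (Finset.mem_inter.2 ⟨hz, h⟩))

include hE hp in
theorem heaviestBasis_of_indep {I : Finset X} (hI : N.Indep I) : N.heaviestBasis p I = I :=
  Finset.coe_injective (hI.eq_of_isBasis (isBasis_heaviestBasis hE hp I))

include hE hp in
/-- In a set that is one element away from independence, the heaviest basis is obtained by removing
the element of lowest priority among those whose removal restores independence. -/
theorem exists_heaviestBasis_insert_eq_erase {I : Finset X} {x : X} (hI : N.Indep I)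
    (hdep : ¬ N.Indep (insert x I : Finset X)) :
    ∃ a ∈ insert x I, N.heaviestBasis p (insert x I) = (insert x I).erase a ∧
      ∀ b ∈ insert x I, N.Indep ((insert x I).erase b : Finset X) → p a ≤ p b := by
  have hx : x ∉ I := fun h => hdep (by rwa [Finset.insert_eq_of_mem h])
  have hbasis := isBasis_heaviestBasis hE hp (insert x I)
  have hne : N.heaviestBasis p (insert x I) ≠ insert x I := fun h => hdep (h ▸ hbasis.indep)
  have hsub := N.heaviestBasis_subset p (insert x I)
  obtain ⟨a, ha, haB⟩ := Finset.exists_of_ssubset (hsub.ssubset_of_ne hne)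
  have heq : N.heaviestBasis p (insert x I) = (insert x I).erase a := by
    refine Finset.eq_of_subset_of_card_le (Finset.subset_erase.2 ⟨hsub, haB⟩) ?_
    rw [Finset.card_erase_of_mem ha, Finset.card_insert_of_notMem hx, Nat.add_sub_cancel]
    exact card_le_card_heaviestBasis hE hp hI (Finset.subset_insert _ _)
  refine ⟨a, ha, heq, fun b hb hbI => ?_⟩
  by_contra hlt
  rw [not_le] at hlt
  have hab : a ≠ b := fun h => absurd hlt (by rw [h]; exact lt_irrefl _)
  have hcl : a ∈ N.closure {y | y ∈ insert x I ∧ p a < p y} := by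
    by_contra hcl
    exact haB (mem_heaviestBasis.2 ⟨ha, hcl⟩)
  refine hbI.notMem_closure_sdiff_of_mem
    (Finset.mem_coe.2 (Finset.mem_erase.2 ⟨hab, ha⟩)) (N.closure_subset_closure ?_ hcl)
  rintro y ⟨hy, hay⟩
  refine ⟨Finset.mem_coe.2 (Finset.mem_erase.2 ⟨?_, hy⟩), ?_⟩
  · rintro rfl
    exact hay.not_gt hlt
  · rintro rfl
    exact lt_irrefl _ hay

end Matroid

/-- If `J` has at least as many elements as `I` above every threshold, then it has at least the
same total weight. -/
theorem Finset.sum_le_sum_of_card_filter_le {X : Type*} [DecidableEq X] {u : X → ℝ}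
    (hu : ∀ x, 0 ≤ u x) {I J : Finset X}
    (h : ∀ θ, (I.filter fun x => θ ≤ u x).card ≤ (J.filter fun x => θ ≤ u x).card) :
    ∑ x ∈ I, u x ≤ ∑ x ∈ J, u x := by
  induction hn : I.card generalizing I J with
  | zero =>
    rw [Finset.card_eq_zero.1 hn, Finset.sum_empty]
    exact Finset.sum_nonneg fun x _ => hu x
  | succ n ih =>
    -- Compare the heaviest elements `i` and `j`, and remove them.
    obtain ⟨i, hi, hmax⟩ := I.exists_max_image u (Finset.card_pos.1 (by omega))
    have hJ : (J.filter fun x => u i ≤ u x).Nonempty :=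
      Finset.card_pos.1 (lt_of_lt_of_le (Finset.card_pos.2 ⟨i, by simp [hi]⟩) (h (u i)))
    obtain ⟨j₀, hj₀⟩ := hJ
    rw [Finset.mem_filter] at hj₀
    obtain ⟨j, hj, hjmax⟩ := J.exists_max_image u ⟨j₀, hj₀.1⟩
    have hij : u i ≤ u j := hj₀.2.trans (hjmax j₀ hj₀.1)
    rw [← Finset.add_sum_erase I u hi, ← Finset.add_sum_erase J u hj]
    refine add_le_add hij (ih (fun θ => ?_) (by rw [Finset.card_erase_of_mem hi, hn]; rfl))
    rw [Finset.filter_erase, Finset.filter_erase]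
    by_cases hθ : θ ≤ u i
    · rw [Finset.card_erase_of_mem (by simp [hi, hθ]),
        Finset.card_erase_of_mem (by simp [hj, hθ.trans hij])]
      exact Nat.sub_le_sub_right (h θ) 1
    · have : I.filter (fun x => θ ≤ u x) = ∅ :=
        Finset.filter_eq_empty_iff.2 fun x hx hx' => hθ (hx'.trans (hmax x hx))
      simp [this]

/-- The heaviest basis has the largest total weight of all independent sets. -/
theorem Matroid.sum_le_sum_heaviestBasis {X κ : Type*} [LinearOrder κ] [DecidableEq X]
    {N : Matroid X} (hE : N.E = Set.univ) {p : X → κ} (hp : Function.Injective p) {u : X → ℝ}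
    (hu : ∀ x, 0 ≤ u x) (hpu : ∀ x y, p x < p y → u x ≤ u y) {I S : Finset X} (hI : N.Indep I)
    (hIS : I ⊆ S) : ∑ x ∈ I, u x ≤ ∑ x ∈ N.heaviestBasis p S, u x := by
  refine Finset.sum_le_sum_of_card_filter_le hu fun θ => ?_
  refine (card_le_card_heaviestBasis (S := S.filter fun x => θ ≤ u x) hE hp (hI.subset ?_) ?_).trans
    (Finset.card_le_card fun x hx => ?_)
  · exact Finset.coe_subset.2 (Finset.filter_subset _ _)
  · exact Finset.filter_subset_filter _ hIS
  · rw [mem_heaviestBasis, Finset.mem_filter] at hx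
    refine Finset.mem_filter.2 ⟨mem_heaviestBasis.2 ⟨hx.1.1, fun hc => hx.2 ?_⟩, hx.1.2⟩
    refine N.closure_subset_closure ?_ hc
    exact fun y hy => ⟨Finset.mem_filter.2 ⟨hy.1, hx.1.2.trans (hpu x y hy.2)⟩, hy.2⟩

/-! ### The matroid of a hospital and its greedy choice -/

namespace Market

variable {D : Type u} {H : Type v} {X : Type w}

/-- The priority of a contract for its hospital: its utility, and its index in case of ties. -/
def priority (M : Market D H X) (x : X) : ℝ ×ₗ X :=
  toLex (M.util x, x)

theorem priority_injective (M : Market D H X) : Function.Injective M.priority :=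
  fun x y h => by simpa [priority] using congrArg (fun z => (ofLex z).2) h

theorem priority_le_iff [LinearOrder X] {M : Market D H X} {x y : X} :
    M.priority x ≤ M.priority y ↔ M.util x < M.util y ∨ (M.util x = M.util y ∧ x ≤ y) := by
  simp [priority, Prod.Lex.le_iff]

theorem util_le_of_priority_lt [LinearOrder X] {M : Market D H X} {x y : X}
    (h : M.priority x < M.priority y) : M.util x ≤ M.util y := by
  rcases priority_le_iff.1 h.le with h | h
  · exact h.le
  · exact h.1.le

variable [Fintype D]

/-- The contract `x` is large at level `t`. -/
def IsLarge (M : Market D H X) (t : ℕ) (x : X) : Prop :=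
  1 / ((t : ℝ) * (M.gamma : ℝ)) < M.size x

open Classical in
/-- The number of contracts in `Y` that are large at level `t`. -/
noncomputable def numLarge (M : Market D H X) (t : ℕ) (Y : Finset X) : ℕ :=
  (Y.filter (M.IsLarge t)).card

theorem isIndep_iff {M : Market D H X} {h : H} {Y : Finset X} :
    M.IsIndep h Y ↔ (∀ x ∈ Y, M.hosp x = h) ∧
      ∀ t : ℕ, 1 ≤ t → t ≤ Fintype.card D → M.numLarge t Y ≤ t :=
  Iff.rfl

theorem IsLarge.mono {M : Market D H X} (hγ : 0 < M.gamma) {t t' : ℕ} (ht : 1 ≤ t) (h : t ≤ t')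
    {x : X} (hx : M.IsLarge t x) : M.IsLarge t' x := by
  have hγ' : (0 : ℝ) < M.gamma := by exact_mod_cast hγ
  have ht' : (0 : ℝ) < t := by exact_mod_cast ht
  have h' : (t : ℝ) ≤ t' := by exact_mod_cast h
  refine lt_of_le_of_lt ?_ hx
  gcongr

theorem numLarge_mono (M : Market D H X) (t : ℕ) {Y Z : Finset X} (h : Y ⊆ Z) :
    M.numLarge t Y ≤ M.numLarge t Z := by
  classical exact Finset.card_le_card (Finset.filter_subset_filter _ h)

theorem numLarge_le_card (M : Market D H X) (t : ℕ) (Y : Finset X) : M.numLarge t Y ≤ Y.card := by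
  classical exact Finset.card_filter_le _ _

theorem numLarge_insert_le [DecidableEq X] (M : Market D H X) (t : ℕ) (x : X) (Y : Finset X) :
    M.numLarge t (insert x Y) ≤ M.numLarge t Y + 1 := by
  classical
  unfold numLarge
  rw [Finset.filter_insert]
  split_ifs
  · exact Finset.card_insert_le _ _
  · exact Nat.le_succ _

theorem numLarge_insert_of_not_isLarge [DecidableEq X] (M : Market D H X) {t : ℕ} {x : X}
    (hx : ¬ M.IsLarge t x) (Y : Finset X) : M.numLarge t (insert x Y) = M.numLarge t Y := by
  classical
  unfold numLarge
  rw [Finset.filter_insert, if_neg hx]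

theorem numLarge_erase_of_isLarge [DecidableEq X] (M : Market D H X) {t : ℕ} {x : X}
    (hx : M.IsLarge t x) {Y : Finset X} (hY : x ∈ Y) :
    M.numLarge t (Y.erase x) + 1 = M.numLarge t Y := by
  classical
  unfold numLarge
  rw [Finset.filter_erase]
  exact Finset.card_erase_add_one (Finset.mem_filter.2 ⟨hY, hx⟩)

theorem numLarge_erase_of_not_isLarge [DecidableEq X] (M : Market D H X) {t : ℕ} {x : X}
    (hx : ¬ M.IsLarge t x) (Y : Finset X) : M.numLarge t (Y.erase x) = M.numLarge t Y := by
  classical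
  unfold numLarge
  rw [Finset.filter_erase, Finset.erase_eq_of_notMem]
  exact fun h => hx (Finset.mem_filter.1 h).2

theorem IsIndep.subset {M : Market D H X} {h : H} {Y Z : Finset X} (hZ : M.IsIndep h Z)
    (hYZ : Y ⊆ Z) : M.IsIndep h Y :=
  ⟨fun x hx => hZ.1 x (hYZ hx), fun t h₁ h₂ => (M.numLarge_mono t hYZ).trans (hZ.2 t h₁ h₂)⟩

/-- The augmentation axiom. Beyond the last level at which `I` meets its bound, `J` has more
contracts than `I`. -/
theorem IsIndep.exists_insert [DecidableEq X] {M : Market D H X} (hγ : 0 < M.gamma) {h : H}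
    {I J : Finset X} (hI : M.IsIndep h I) (hJ : M.IsIndep h J) (hcard : I.card < J.card) :
    ∃ e ∈ J, e ∉ I ∧ M.IsIndep h (insert e I) := by
  classical
  obtain ⟨e, heJ, heI, s, hs, hs'⟩ : ∃ e ∈ J, e ∉ I ∧ ∃ s : ℕ,
      (∀ t, 1 ≤ t → t ≤ s → ¬ M.IsLarge t e) ∧
      ∀ t, s < t → t ≤ Fintype.card D → M.numLarge t I < t := by
    by_cases hT : ((Finset.Icc 1 (Fintype.card D)).filter fun t => M.numLarge t I = t).Nonempty
    · obtain ⟨s, hs, hmax⟩ := Finset.exists_max_image _ id hT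
      rw [Finset.mem_filter, Finset.mem_Icc] at hs
      have hI' := Finset.card_filter_add_card_filter_not (s := I) (M.IsLarge s)
      have hJ' := Finset.card_filter_add_card_filter_not (s := J) (M.IsLarge s)
      have hlt : (I.filter fun x => ¬ M.IsLarge s x).card <
          (J.filter fun x => ¬ M.IsLarge s x).card := by
        have h₁ := hJ.2 s hs.1.1 hs.1.2
        have h₂ := hs.2
        unfold numLarge at h₂
        unfold IsLarge at *
        omega
      obtain ⟨e, heJ, heI⟩ := Finset.exists_mem_notMem_of_card_lt_card hlt
      rw [Finset.mem_filter] at heJ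
      refine ⟨e, heJ.1, fun h => heI (Finset.mem_filter.2 ⟨h, heJ.2⟩), s, fun t h₁ h₂ hl =>
        heJ.2 (hl.mono hγ h₁ h₂), fun t h₁ h₂ => ?_⟩
      refine (hI.2 t (by omega) h₂).lt_of_ne fun heq => absurd (hmax t ?_) (not_le.2 h₁)
      exact Finset.mem_filter.2 ⟨Finset.mem_Icc.2 ⟨by omega, h₂⟩, heq⟩
    · obtain ⟨e, heJ, heI⟩ := Finset.exists_mem_notMem_of_card_lt_card hcard
      refine ⟨e, heJ, heI, 0, fun t h₁ h₂ => by omega, fun t h₁ h₂ => ?_⟩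
      refine (hI.2 t (by omega) h₂).lt_of_ne fun heq => hT ⟨t, ?_⟩
      exact Finset.mem_filter.2 ⟨Finset.mem_Icc.2 ⟨by omega, h₂⟩, heq⟩
  refine ⟨e, heJ, heI, fun x hx => ?_, fun t h₁ h₂ => ?_⟩
  · rcases Finset.mem_insert.1 hx with rfl | hx
    · exact hJ.1 _ heJ
    · exact hI.1 _ hx
  · change M.numLarge t (insert e I) ≤ t
    by_cases hts : t ≤ s
    · rw [M.numLarge_insert_of_not_isLarge (hs t h₁ hts)]
      exact hI.2 t h₁ h₂
    · exact (M.numLarge_insert_le t e I).trans (hs' t (not_le.1 hts) h₂)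

theorem isIndep_empty (M : Market D H X) (h : H) : M.IsIndep h ∅ :=
  ⟨by simp, by simp⟩

/-- The matroid of the hospital `h`; contracts with other hospitals are loops. -/
noncomputable def matroid (M : Market D H X) (hγ : 0 < M.gamma) (h : H) : Matroid X :=
  open Classical in
  (IndepMatroid.ofFinset Set.univ (M.IsIndep h) (M.isIndep_empty h)
    (fun _ _ hJ hIJ => hJ.subset hIJ)
    (fun _ _ hI hJ => hI.exists_insert hγ hJ) (fun _ _ => Set.subset_univ _)).matroid

theorem matroid_ground (M : Market D H X) (hγ : 0 < M.gamma) (h : H) :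
    (M.matroid hγ h).E = Set.univ :=
  rfl

theorem matroid_indep {M : Market D H X} {hγ : 0 < M.gamma} {h : H} {I : Finset X} :
    (M.matroid hγ h).Indep (I : Set X) ↔ M.IsIndep h I := by
  classical
  simp [matroid]

variable [LinearOrder X]

theorem IsDiscarded.eq {M : Market D H X} {h : H} {Y : Finset X} {a b : X}
    (ha : M.IsDiscarded h Y a) (hb : M.IsDiscarded h Y b) : a = b :=
  M.priority_injective (le_antisymm (priority_le_iff.2 (ha.2.2 b hb.1 hb.2.1))
    (priority_le_iff.2 (hb.2.2 a ha.1 ha.2.1)))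

theorem greedyStep_of_isIndep {M : Market D H X} {h : H} {Y : Finset X} {x : X}
    (hY : M.IsIndep h (insert x Y)) : M.greedyStep h Y x = insert x Y :=
  if_pos hY

theorem greedyStep_of_isDiscarded {M : Market D H X} {h : H} {Y : Finset X} {x a : X}
    (hY : ¬ M.IsIndep h (insert x Y)) (ha : M.IsDiscarded h (insert x Y) a) :
    M.greedyStep h Y x = (insert x Y).erase a := by
  classical
  rw [greedyStep, if_neg hY]
  ext z
  rw [Finset.mem_filter, Finset.mem_erase]
  constructor
  · rintro ⟨h₁, h₂⟩
    exact ⟨fun h => h₂ (h ▸ ha), h₁⟩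
  · rintro ⟨h₁, h₂⟩
    exact ⟨h₂, fun hz => h₁ (hz.eq ha)⟩

theorem heaviestBasis_insert_eq_greedyStep {M : Market D H X} (hγ : 0 < M.gamma) {h : H}
    {I : Finset X} (hI : M.IsIndep h I) (x : X) :
    (M.matroid hγ h).heaviestBasis M.priority (insert x I) = M.greedyStep h I x := by
  by_cases hY : M.IsIndep h (insert x I)
  · rw [greedyStep_of_isIndep hY]
    exact Matroid.heaviestBasis_of_indep (M.matroid_ground hγ h) M.priority_injective
      (matroid_indep.2 hY)
  · obtain ⟨a, ha, heq, hmin⟩ := Matroid.exists_heaviestBasis_insert_eq_erase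
      (M.matroid_ground hγ h) M.priority_injective (matroid_indep.2 hI)
      (fun hc => hY (matroid_indep.1 hc))
    rw [heq, greedyStep_of_isDiscarded hY]
    refine ⟨ha, ?_, fun b hb hbI => priority_le_iff.1 (hmin b hb (matroid_indep.2 hbI))⟩
    rw [← heq, ← matroid_indep (hγ := hγ)]
    exact (Matroid.isBasis_heaviestBasis (M.matroid_ground hγ h) M.priority_injective _).indep

/-- The greedy choice from a sequence depends only on the set of its members. -/
theorem greedyChoice_eq {M : Market D H X} (hγ : 0 < M.gamma) {h : H} {l : List X}
    (hl : ∀ x ∈ l, M.hosp x = h) :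
    M.greedyChoice h l = (M.matroid hγ h).heaviestBasis M.priority l.toFinset := by
  have hE := M.matroid_ground hγ h
  induction l using List.reverseRecOn with
  | nil => exact (Finset.subset_empty.1 (Matroid.heaviestBasis_subset _ _ ∅)).symm
  | append_singleton l x ih =>
    have ih' := ih fun y hy => hl y (List.mem_append_left _ hy)
    have hI : M.IsIndep h (M.greedyChoice h l) := by
      rw [ih', ← matroid_indep (hγ := hγ)]
      exact (Matroid.isBasis_heaviestBasis hE M.priority_injective _).indep
    have hins : (l ++ [x]).toFinset = insert x l.toFinset := by ext; simp
    have : M.greedyChoice h (l ++ [x]) = M.greedyStep h (M.greedyChoice h l) x := by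
      simp [greedyChoice]
    rw [this, ← heaviestBasis_insert_eq_greedyStep hγ hI x, ih', hins,
      Matroid.heaviestBasis_insert_heaviestBasis hE M.priority_injective]

/-- The joint choice of all hospitals from a set of contracts. -/
noncomputable def choice (M : Market D H X) (hγ : 0 < M.gamma) (S : Finset X) : Finset X :=
  S.filter fun x => x ∈ (M.matroid hγ (M.hosp x)).heaviestBasis M.priority S

theorem choice_subset (M : Market D H X) (hγ : 0 < M.gamma) (S : Finset X) :
    M.choice hγ S ⊆ S :=
  Finset.filter_subset _ _

theorem hosp_eq_of_mem_heaviestBasis {M : Market D H X} {hγ : 0 < M.gamma} {h : H} {S : Finset X}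
    {x : X} (hx : x ∈ (M.matroid hγ h).heaviestBasis M.priority S) : M.hosp x = h :=
  (matroid_indep.1 (Matroid.isBasis_heaviestBasis (M.matroid_ground hγ h)
    M.priority_injective S).indep).1 x hx

theorem ofHospital_choice [DecidableEq H] (M : Market D H X) (hγ : 0 < M.gamma) (S : Finset X)
    (h : H) :
    M.ofHospital (M.choice hγ S) h = (M.matroid hγ h).heaviestBasis M.priority S := by
  ext x
  rw [ofHospital, choice, Finset.mem_filter, Finset.mem_filter]
  constructor
  · rintro ⟨⟨_, h₁⟩, rfl⟩
    exact h₁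
  · intro hx
    obtain rfl := hosp_eq_of_mem_heaviestBasis hx
    exact ⟨⟨Matroid.heaviestBasis_subset _ _ _ hx, hx⟩, rfl⟩

theorem heaviestBasis_ofHospital [DecidableEq H] (M : Market D H X) (hγ : 0 < M.gamma)
    (S : Finset X) (h : H) :
    (M.matroid hγ h).heaviestBasis M.priority (M.ofHospital S h) =
      (M.matroid hγ h).heaviestBasis M.priority S :=
  Matroid.heaviestBasis_eq_of_subset (M.matroid_ground hγ h) M.priority_injective
    (Finset.filter_subset _ _) fun _ hx => Finset.mem_filter.2
      ⟨Matroid.heaviestBasis_subset _ _ _ hx, hosp_eq_of_mem_heaviestBasis hx⟩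

/-- Substitutability: a contract that is chosen from a set is chosen from every smaller set. -/
theorem choice_inter_subset (M : Market D H X) (hγ : 0 < M.gamma) ⦃R S : Finset X⦄ (h : R ⊆ S) :
    M.choice hγ S ∩ R ⊆ M.choice hγ R := by
  intro x hx
  rw [Finset.mem_inter, choice, Finset.mem_filter] at hx
  exact Finset.mem_filter.2 ⟨hx.2, Matroid.heaviestBasis_inter_subset _ _ h
    (Finset.mem_inter.2 ⟨hx.1.2, hx.2⟩)⟩

/-- The law of aggregate demand. -/
theorem card_choice_mono [Fintype H] [DecidableEq H] (M : Market D H X) (hγ : 0 < M.gamma)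
    ⦃R S : Finset X⦄ (h : R ⊆ S) : (M.choice hγ R).card ≤ (M.choice hγ S).card := by
  have hsum : ∀ T, (M.choice hγ T).card =
      ∑ h, ((M.matroid hγ h).heaviestBasis M.priority T).card := by
    intro T
    rw [Finset.card_eq_sum_card_fiberwise (f := M.hosp) (t := Finset.univ) (by simp)]
    exact Finset.sum_congr rfl fun h _ => congrArg _ (M.ofHospital_choice hγ T h)
  rw [hsum, hsum]
  exact Finset.sum_le_sum fun h' _ => Matroid.card_heaviestBasis_mono (M.matroid_ground hγ h')
    M.priority_injective h

end Market

/-! ### Independent sets, budgets, and the approximation guarantee -/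

/-- The number of elements of `Y` with a key above that of `x`. -/
def Finset.rankAbove {X κ : Type*} [LinearOrder κ] (p : X → κ) (Y : Finset X) (x : X) : ℕ :=
  (Y.filter fun y => p x < p y).card

namespace Finset

variable {X κ : Type*} [LinearOrder κ] {p : X → κ} {Y : Finset X}

theorem rankAbove_lt_card_filter {q : X → Prop} [DecidablePred q] {x : X} (hx : x ∈ Y)
    (hq : ∀ y ∈ Y, p x ≤ p y → q y) : Y.rankAbove p x < (Y.filter q).card := by
  refine Finset.card_lt_card ((Finset.ssubset_iff_of_subset fun y hy => ?_).2
    ⟨x, Finset.mem_filter.2 ⟨hx, hq x hx le_rfl⟩, fun h => ?_⟩)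
  · rw [Finset.mem_filter] at hy ⊢
    exact ⟨hy.1, hq y hy.1 hy.2.le⟩
  · exact lt_irrefl _ (Finset.mem_filter.1 h).2

theorem rankAbove_lt_of_lt {x y : X} (hy : y ∈ Y) (h : p x < p y) :
    Y.rankAbove p y < Y.rankAbove p x :=
  rankAbove_lt_card_filter hy fun _ _ hz => h.trans_le hz

theorem rankAbove_injOn (hp : Function.Injective p) : Set.InjOn (Y.rankAbove p) Y := by
  intro x hx y hy hxy
  by_contra hne
  rcases lt_or_gt_of_ne fun h => hne (hp h) with h | h
  · exact (rankAbove_lt_of_lt hy h).ne hxy.symm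
  · exact (rankAbove_lt_of_lt hx h).ne hxy

theorem rankAbove_lt_card {x : X} (hx : x ∈ Y) : Y.rankAbove p x < Y.card := by
  simpa using rankAbove_lt_card_filter (q := fun _ => True) (p := p) hx fun _ _ _ => trivial

end Finset

namespace Market

variable {D : Type u} {H : Type v} {X : Type w}

theorem size_le_maxSize [Finite X] (M : Market D H X) (x : X) : M.size x ≤ M.maxSize :=
  le_ciSup (Set.finite_range M.size).bddAbove x

/-- The order of the contracts by size, with ties broken by index. -/
def sizeKey (M : Market D H X) (x : X) : ℝ ×ₗ X :=
  toLex (M.size x, x)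

theorem sizeKey_injective (M : Market D H X) : Function.Injective M.sizeKey :=
  fun x y h => by simpa [sizeKey] using congrArg (fun z => (ofLex z).2) h

theorem size_le_of_sizeKey_le [LinearOrder X] {M : Market D H X} {x y : X}
    (h : M.sizeKey x ≤ M.sizeKey y) : M.size x ≤ M.size y := by
  rw [sizeKey, sizeKey, Prod.Lex.le_iff] at h
  rcases h with h | h
  · exact h.le
  · exact h.1.le

variable [Fintype D]

theorem one_le_one_add_log (hD : 2 ≤ Fintype.card D) :
    1 ≤ 1 + Real.log ((Fintype.card D : ℝ) - 1) := by
  have h : (2 : ℝ) ≤ Fintype.card D := by exact_mod_cast hD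
  linarith [Real.log_nonneg (show (1 : ℝ) ≤ (Fintype.card D : ℝ) - 1 by linarith)]

theorem gamma_pos (M : Market D H X) (hD : 2 ≤ Fintype.card D) (hs : M.maxSize < 1) :
    0 < M.gamma :=
  Int.ceil_pos.2 (div_pos (by linarith [one_le_one_add_log hD]) (by linarith))

/-- A set of contracts within the budget contains at most `t * γ` contracts that are large at
level `t`. -/
theorem numLarge_le_of_totalSize_le_one {M : Market D H X} (hγ : 0 < M.gamma) {B : Finset X}
    (hB : M.totalSize B ≤ 1) {t : ℕ} (ht : 1 ≤ t) :
    (M.numLarge t B : ℝ) ≤ (t : ℝ) * (M.gamma : ℝ) := by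
  classical
  have hγ' : (0 : ℝ) < M.gamma := by exact_mod_cast hγ
  have ht' : (0 : ℝ) < t := by exact_mod_cast ht
  have h₁ : (M.numLarge t B : ℝ) * (1 / ((t : ℝ) * (M.gamma : ℝ))) ≤ 1 := by
    rw [← nsmul_eq_mul]
    refine (Finset.card_nsmul_le_sum _ M.size _ fun x hx => ?_).trans (le_trans
      (Finset.sum_le_sum_of_subset_of_nonneg (Finset.filter_subset (M.IsLarge t) B)
        fun x _ _ => M.size_nonneg x) hB)
    exact (Finset.mem_filter.1 hx).2.le
  rwa [mul_one_div, div_le_one (by positivity)] at h₁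

variable [LinearOrder X]

/-- The contract at position `i`, counted from 0, in the order of decreasing size cannot be large
at level `i`. -/
theorem IsIndep.size_le {M : Market D H X} {h : H} {Y : Finset X}
    (hY : M.IsIndep h Y) {x : X} (hx : x ∈ Y) (h₀ : Y.rankAbove M.sizeKey x ≠ 0)
    (h₁ : Y.rankAbove M.sizeKey x ≤ Fintype.card D) :
    M.size x ≤ 1 / ((Y.rankAbove M.sizeKey x : ℝ) * (M.gamma : ℝ)) := by
  classical
  by_contra hlt
  rw [not_le] at hlt
  have h₂ := hY.2 _ (Nat.one_le_iff_ne_zero.2 h₀) h₁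
  refine absurd h₂ (not_le.2 ?_)
  exact Finset.rankAbove_lt_card_filter (q := M.IsLarge (Y.rankAbove M.sizeKey x)) hx
    fun y _ hxy => lt_of_lt_of_le hlt (size_le_of_sizeKey_le hxy)

/-- Independent sets with at most one contract per doctor respect the budget: the largest contract
has size at most `s̄`, and the other ones have total size at most `H_{|D|-1} / γ ≤ 1 - s̄`. -/
theorem IsIndep.totalSize_le_one [Fintype X] [Nonempty X] {M : Market D H X} {h : H} {Y : Finset X}
    (hD : 2 ≤ Fintype.card D) (hs : M.maxSize < 1) (hY : M.IsIndep h Y)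
    (hcard : Y.card ≤ Fintype.card D) : M.totalSize Y ≤ 1 := by
  have hγ := M.gamma_pos hD hs
  have hγ' : (0 : ℝ) < M.gamma := by exact_mod_cast hγ
  have hs₀ : 0 ≤ M.maxSize :=
    (M.size_nonneg _).trans (M.size_le_maxSize (Classical.arbitrary X))
  set r := Y.rankAbove M.sizeKey with hr
  set f : ℕ → ℝ := fun i => if i = 0 then M.maxSize else 1 / ((i : ℝ) * (M.gamma : ℝ)) with hf
  have hf₀ : ∀ i, 0 ≤ f i := by
    intro i
    simp only [hf]
    split_ifs
    · exact hs₀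
    · positivity
  have hrlt : ∀ x ∈ Y, r x < Fintype.card D := fun x hx =>
    (Finset.rankAbove_lt_card hx).trans_le hcard
  have h₁ : ∀ x ∈ Y, M.size x ≤ f (r x) := by
    intro x hx
    simp only [hf]
    split_ifs with h₀
    · exact M.size_le_maxSize x
    · exact hY.size_le hx h₀ (hrlt x hx).le
  have h₂ : ∑ x ∈ Y, f (r x) ≤ ∑ i ∈ Finset.range (Fintype.card D), f i := by
    rw [← Finset.sum_image (Finset.rankAbove_injOn M.sizeKey_injective)]
    refine Finset.sum_le_sum_of_subset_of_nonneg (fun i hi => ?_) fun i _ _ => hf₀ i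
    obtain ⟨x, hx, rfl⟩ := Finset.mem_image.1 hi
    exact Finset.mem_range.2 (hrlt x hx)
  obtain ⟨n, hn⟩ : ∃ n, Fintype.card D = n + 1 := ⟨Fintype.card D - 1, by omega⟩
  have h₃ : ∑ i ∈ Finset.range (Fintype.card D), f i =
      M.maxSize + (harmonic n : ℝ) / M.gamma := by
    rw [hn, Finset.sum_range_succ', add_comm]
    simp only [hf, if_true, Nat.add_eq_zero_iff, one_ne_zero, and_false, if_false, harmonic]
    push_cast
    rw [Finset.sum_div]
    congr 1
    refine Finset.sum_congr rfl fun i _ => ?_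
    field_simp
  have h₄ : (harmonic n : ℝ) ≤ 1 + Real.log ((Fintype.card D : ℝ) - 1) := by
    rw [hn]
    push_cast
    rw [add_sub_cancel_right]
    exact harmonic_le_one_add_log n
  have h₅ : (harmonic n : ℝ) / M.gamma ≤ 1 - M.maxSize := by
    rw [div_le_iff₀ hγ', mul_comm]
    refine h₄.trans ((div_le_iff₀ (by linarith)).1 ?_)
    exact Int.le_ceil _
  calc M.totalSize Y ≤ ∑ x ∈ Y, f (r x) := Finset.sum_le_sum h₁
    _ ≤ M.maxSize + (harmonic n : ℝ) / M.gamma := h₂.trans h₃.le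
    _ ≤ 1 := by linarith

/-- Distributing the contracts of `B` in the order of decreasing size over `γ` classes in turn,
one obtains independent sets. -/
theorem isIndep_filter_rankAbove_mod {M : Market D H X} (hγ : 0 < M.gamma) {h : H} {B : Finset X}
    (hBh : ∀ x ∈ B, M.hosp x = h) (hB : M.totalSize B ≤ 1) (r : ℕ) :
    M.IsIndep h (B.filter fun x => B.rankAbove M.sizeKey x % M.gamma.toNat = r) := by
  classical
  refine ⟨fun x hx => hBh x (Finset.mem_filter.1 hx).1, fun t ht _ => ?_⟩
  have hN : M.numLarge t B ≤ t * M.gamma.toNat := by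
    have h₁ := numLarge_le_of_totalSize_le_one hγ hB ht
    have h₂ : ((M.gamma.toNat : ℕ) : ℝ) = (M.gamma : ℝ) := by
      exact_mod_cast congrArg (Int.cast : ℤ → ℝ) (Int.toNat_of_nonneg hγ.le)
    rw [← h₂] at h₁
    exact_mod_cast h₁
  -- Within a residue class, the quotient determines the position.
  refine le_of_le_of_eq (Finset.card_le_card_of_injOn (t := Finset.range t)
    (fun x => B.rankAbove M.sizeKey x / M.gamma.toNat)
    (fun x hx => ?_) fun x hx y hy hxy => ?_) (Finset.card_range t)
  · rw [Finset.mem_coe, Finset.mem_filter, Finset.mem_filter] at hx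
    rw [Finset.mem_coe, Finset.mem_range, Nat.div_lt_iff_lt_mul (by omega)]
    refine lt_of_lt_of_le ?_ hN
    exact Finset.rankAbove_lt_card_filter (q := M.IsLarge t) hx.1.1
      fun y _ hxy => lt_of_lt_of_le hx.2 (size_le_of_sizeKey_le hxy)
  · rw [Finset.mem_coe, Finset.mem_filter, Finset.mem_filter] at hx hy
    refine Finset.rankAbove_injOn M.sizeKey_injective hx.1.1 hy.1.1 ?_
    simp only at hxy
    rw [← Nat.div_add_mod (B.rankAbove M.sizeKey x) M.gamma.toNat,
      ← Nat.div_add_mod (B.rankAbove M.sizeKey y) M.gamma.toNat, hxy, hx.1.2, hy.1.2]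

/-- The approximation guarantee: the heaviest basis of `S` has at least a `γ`-th part of the
utility of every set of contracts in `S` with the hospital that is within the budget. -/
theorem totalUtil_le_gamma_mul {M : Market D H X} (hγ : 0 < M.gamma) {h : H} {B S : Finset X}
    (hBS : B ⊆ S) (hBh : ∀ x ∈ B, M.hosp x = h) (hB : M.totalSize B ≤ 1) :
    M.totalUtil B ≤
      (M.gamma : ℝ) * M.totalUtil ((M.matroid hγ h).heaviestBasis M.priority S) := by
  have hsum : M.totalUtil B = ∑ r ∈ Finset.range M.gamma.toNat,
      ∑ x ∈ B.filter (fun x => B.rankAbove M.sizeKey x % M.gamma.toNat = r), M.util x := by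
    refine (Finset.sum_fiberwise_of_maps_to (fun x _ => ?_) M.util).symm
    exact Finset.mem_range.2 (Nat.mod_lt _ (by omega))
  have h₂ : ((M.gamma.toNat : ℕ) : ℝ) = (M.gamma : ℝ) := by
    exact_mod_cast congrArg (Int.cast : ℤ → ℝ) (Int.toNat_of_nonneg hγ.le)
  rw [hsum, ← h₂, ← nsmul_eq_mul]
  refine (Finset.sum_le_card_nsmul _ _ _ fun r _ => ?_).trans_eq (by rw [Finset.card_range])
  exact Matroid.sum_le_sum_heaviestBasis (M.matroid_ground hγ h) M.priority_injective M.util_nonneg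
    (fun _ _ => util_le_of_priority_lt)
    (matroid_indep.2 (isIndep_filter_rankAbove_mod hγ hBh hB r))
    ((Finset.filter_subset _ _).trans hBS)

end Market

/-! ### The runs of generalized deferred acceptance -/

namespace Market

section Preferences

variable {D : Type u} {H : Type v} {X : Type w} {M : Market D H X}

theorem Profile.pref_trans (P : M.Profile) {d : D} {a b c : Option (M.Contr d)}
    (h₁ : P.pref d a b) (h₂ : P.pref d b c) : P.pref d a c :=
  have := P.strict_total d
  _root_.trans h₁ h₂

theorem Profile.pref_irrefl (P : M.Profile) {d : D} (a : Option (M.Contr d)) : ¬ P.pref d a a :=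
  have := P.strict_total d
  irrefl_of (P.pref d) a

theorem Profile.pref_total (P : M.Profile) {d : D} {a b : Option (M.Contr d)} (h : a ≠ b) :
    P.pref d a b ∨ P.pref d b a :=
  have := P.strict_total d
  (trichotomous_of (P.pref d) a b).imp_right fun h' => h'.resolve_left h

/-- The contract `x` is acceptable to its doctor. -/
def Profile.Acc (P : M.Profile) (x : X) : Prop :=
  P.pref (M.doc x) (some ⟨x, rfl⟩) none

/-- The contracts `y` and `x` have the same doctor, and she strictly prefers `y`. -/
def Profile.Better (P : M.Profile) (y x : X) : Prop :=
  ∃ hy : M.doc y = M.doc x, P.pref (M.doc x) (some ⟨y, hy⟩) (some ⟨x, rfl⟩)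

theorem Profile.acc_iff (P : M.Profile) {x : X} {d : D} (hx : M.doc x = d) :
    P.pref d (some ⟨x, hx⟩) none ↔ P.Acc x := by
  subst hx
  rfl

theorem Profile.better_iff (P : M.Profile) {x y : X} {d : D} (hy : M.doc y = d)
    (hx : M.doc x = d) : P.pref d (some ⟨y, hy⟩) (some ⟨x, hx⟩) ↔ P.Better y x := by
  subst hx
  exact ⟨fun h => ⟨hy, h⟩, fun ⟨_, h⟩ => h⟩

theorem Profile.better_total (P : M.Profile) {x y : X} (h : M.doc y = M.doc x) (hne : y ≠ x) :
    P.Better y x ∨ P.Better x y := by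
  rw [← P.better_iff h rfl, ← P.better_iff rfl h]
  exact P.pref_total (by simpa using hne)

/-- The preference lists of a profile. -/
def Profile.lists (P : M.Profile) : PrefLists M.doc where
  acc := P.Acc
  better := P.Better
  doc_eq h := h.1
  irrefl _ h := P.pref_irrefl _ h.2
  trans := by
    rintro z y x ⟨hz, hzy⟩ ⟨hy, hyx⟩
    rw [P.better_iff, ← P.better_iff (hz.trans hy) hy] at hzy
    exact ⟨hz.trans hy, P.pref_trans hzy hyx⟩
  acc_of_better := by
    rintro y x ⟨hy, hyx⟩ hx
    exact (P.acc_iff hy).1 (P.pref_trans hyx hx)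
  total h hne _ _ := P.better_total h hne

theorem Profile.better_asymm (P : M.Profile) {x y : X} (h : P.Better y x) : ¬ P.Better x y :=
  fun h' => P.lists.irrefl x (P.lists.trans h' h)

end Preferences

section Runs

variable {D : Type u} {H : Type v} {X : Type w} [DecidableEq D] [Fintype X] [DecidableEq X]
  {M : Market D H X} {P : M.Profile} {Ch : H → List X → Finset X}

theorem mem_nextProposal {S : DAState H X} {d : D} {x : X} :
    x ∈ M.nextProposal P S d ↔ M.doc x = d ∧ x ∉ S.proposed ∧ P.Acc x ∧
      ∀ y ∉ S.proposed, M.doc y = d → y ≠ x → P.Better x y := by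
  classical
  have hA : ∀ z, z ∈ M.ofDoctor Finset.univ d \ M.ofDoctor S.proposed d ↔
      M.doc z = d ∧ z ∉ S.proposed := by
    intro z
    simp only [ofDoctor, Finset.mem_sdiff, Finset.mem_filter, Finset.mem_univ, true_and]
    tauto
  rw [nextProposal, doctorChoice, Finset.mem_filter, hA]
  constructor
  · rintro ⟨⟨_, hx⟩, rfl, hacc, hbest⟩
    exact ⟨rfl, hx, hacc, fun y hy hyd hne => (P.better_iff rfl hyd).1
      (hbest y ((hA y).2 ⟨hyd, hy⟩) hyd hne)⟩
  · rintro ⟨rfl, hx, hacc, hbest⟩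
    exact ⟨⟨rfl, hx⟩, rfl, hacc, fun y hy hyd hne => (P.better_iff rfl hyd).2
      (hbest y ((hA y).1 hy).2 hyd hne)⟩

theorem nextProposal_eq_singleton {S : DAState H X} {d : D} {x : X}
    (hx : x ∈ M.nextProposal P S d) : M.nextProposal P S d = {x} := by
  refine Finset.eq_singleton_iff_unique_mem.2 ⟨hx, fun y hy => ?_⟩
  by_contra hne
  rw [mem_nextProposal] at hx hy
  exact P.better_asymm (hx.2.2.2 y hy.2.1 hy.1 hne) (hy.2.2.2 x hx.2.1 hx.1 (Ne.symm hne))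

theorem not_isActive_iff {S : DAState H X} : (∀ d, ¬ M.IsActive P S d) ↔
    ∀ x, x ∈ M.nextProposal P S (M.doc x) → ∃ y ∈ S.held, M.doc y = M.doc x := by
  constructor
  · intro h x hx
    by_contra hn
    push Not at hn
    exact h _ ⟨Finset.filter_eq_empty_iff.2 hn, Finset.ne_empty_of_mem hx⟩
  · rintro h d ⟨h₁, h₂⟩
    obtain ⟨x, hx⟩ := Finset.nonempty_iff_ne_empty.2 h₂
    obtain rfl := (mem_nextProposal.1 hx).1
    obtain ⟨y, hy, hyx⟩ := h x hx
    exact Finset.filter_eq_empty_iff.1 h₁ hy hyx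

variable [DecidableEq H]

/-- The state after the proposal `x`. -/
def DAState.next (M : Market D H X) (Ch : H → List X → Finset X) (S : DAState H X) (x : X) :
    DAState H X where
  seq := Function.update S.seq (M.hosp x) (S.seq (M.hosp x) ++ [x])
  held := Ch (M.hosp x) (S.seq (M.hosp x) ++ [x]) ∪ S.held.filter (fun y => M.hosp y ≠ M.hosp x)
  proposed := insert x S.proposed

theorem daStep_iff {S T : DAState H X} : M.DAStep Ch P S T ↔
    ∃ x, (∀ y ∈ S.held, M.doc y ≠ M.doc x) ∧ x ∈ M.nextProposal P S (M.doc x) ∧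
      T = S.next M Ch x := by
  constructor
  · rintro ⟨d, x, hact, hx, h₁, h₂, h₃⟩
    have hx' : x ∈ M.nextProposal P S d := by simp [hx]
    obtain rfl := (mem_nextProposal.1 hx').1
    refine ⟨x, fun y hy hyd => ?_, hx', ?_⟩
    · have : y ∈ M.ofDoctor S.held (M.doc x) := Finset.mem_filter.2 ⟨hy, hyd⟩
      rw [hact.1] at this
      exact Finset.notMem_empty _ this
    · cases T
      simp only at h₁ h₂ h₃
      subst h₁ h₂ h₃
      simp [DAState.next]
  · rintro ⟨x, hfree, hx, rfl⟩
    refine ⟨M.doc x, x, ⟨?_, Finset.ne_empty_of_mem hx⟩, nextProposal_eq_singleton hx, rfl, ?_, rfl⟩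
    · exact Finset.filter_eq_empty_iff.2 hfree
    · simp [DAState.next]

theorem card_proposed_lt_of_daStep {S T : DAState H X} (h : M.DAStep Ch P S T) :
    S.proposed.card < T.proposed.card := by
  obtain ⟨x, _, hx, rfl⟩ := daStep_iff.1 h
  exact Finset.card_lt_card (Finset.ssubset_insert (mem_nextProposal.1 hx).2.1)

theorem daTerminates (M : Market D H X) (Ch : H → List X → Finset X) (P : M.Profile) :
    M.DATerminates Ch P := by
  rintro ⟨r, _, hr⟩
  have h : ∀ i, i ≤ (r i).proposed.card := by
    intro i
    induction i with
    | zero => exact Nat.zero_le _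
    | succ i ih => exact ih.trans_lt (card_proposed_lt_of_daStep (hr i))
  have := h (Fintype.card X + 1)
  have := Finset.card_le_univ (r (Fintype.card X + 1)).proposed
  omega

theorem exists_daOutcome (M : Market D H X) (Ch : H → List X → Finset X) (P : M.Profile) :
    ∃ A, M.DAOutcome Ch P A := by
  have key : ∀ n, ∀ S : DAState H X, Fintype.card X - S.proposed.card = n →
      ∃ T, Relation.ReflTransGen (M.DAStep Ch P) S T ∧ ∀ d, ¬ M.IsActive P T d := by
    intro n
    induction n using Nat.strong_induction_on with
    | _ n ih =>
      intro S hS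
      by_cases hact : ∀ d, ¬ M.IsActive P S d
      · exact ⟨S, .refl, hact⟩
      · rw [not_isActive_iff] at hact
        push Not at hact
        obtain ⟨x, hx, hfree⟩ := hact
        have hstep : M.DAStep Ch P S (S.next M Ch x) := daStep_iff.2 ⟨x, hfree, hx, rfl⟩
        have h₁ := card_proposed_lt_of_daStep hstep
        have h₂ := Finset.card_le_univ (S.next M Ch x).proposed
        obtain ⟨T, hT, hT'⟩ := ih _ (by omega) (S.next M Ch x) rfl
        exact ⟨T, .head hstep hT, hT'⟩
  obtain ⟨T, hT, hT'⟩ := key _ daStart rfl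
  exact ⟨T.held, T, hT, hT', rfl⟩

end Runs

section Outcome

variable {D : Type u} {H : Type v} {X : Type w} [DecidableEq H] [LinearOrder X]
  {M : Market D H X} {P : M.Profile}

theorem ofHospital_insert_of_ne {S : Finset X} {x : X} {h : H} (hx : M.hosp x ≠ h) :
    M.ofHospital (insert x S) h = M.ofHospital S h := by
  rw [ofHospital, ofHospital, Finset.filter_insert, if_neg hx]

theorem ofHospital_insert_self (x : X) (S : Finset X) :
    M.ofHospital (insert x S) (M.hosp x) = insert x (M.ofHospital S (M.hosp x)) := by
  rw [ofHospital, ofHospital, Finset.filter_insert, if_pos rfl]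

theorem toFinset_seq_next {S : DAState H X} {Ch : H → List X → Finset X}
    (hS : ∀ h, (S.seq h).toFinset = M.ofHospital S.proposed h) (x : X) (h : H) :
    ((S.next M Ch x).seq h).toFinset = M.ofHospital (insert x S.proposed) h := by
  by_cases hxh : M.hosp x = h
  · subst hxh
    rw [DAState.next, ofHospital, Finset.filter_insert, if_pos rfl]
    simp only [Function.update_self, List.toFinset_append, hS, ofHospital]
    ext
    simp
  · rw [ofHospital_insert_of_ne hxh, DAState.next, ← hS]
    simp only
    rw [Function.update_of_ne (Ne.symm hxh)]

variable [Fintype D]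

theorem greedyChoice_eq_ofHospital_choice {hγ : 0 < M.gamma} {h : H} {l : List X} {S : Finset X}
    (hl : l.toFinset = M.ofHospital S h) : M.greedyChoice h l = M.ofHospital (M.choice hγ S) h := by
  rw [ofHospital_choice, ← heaviestBasis_ofHospital, ← hl]
  refine greedyChoice_eq hγ fun x hx => ?_
  rw [← List.mem_toFinset, hl] at hx
  exact (Finset.mem_filter.1 hx).2

theorem held_next {hγ : 0 < M.gamma} {S : DAState H X}
    (hS : ∀ h, (S.seq h).toFinset = M.ofHospital S.proposed h)
    (hheld : S.held = M.choice hγ S.proposed) (x : X) :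
    (S.next M M.greedyChoice x).held = M.choice hγ (insert x S.proposed) := by
  have hseq := toFinset_seq_next (Ch := M.greedyChoice) hS x (M.hosp x)
  simp only [DAState.next, Function.update_self] at hseq ⊢
  rw [greedyChoice_eq_ofHospital_choice (hγ := hγ) hseq, hheld]
  ext z
  have hz : ∀ T, z ∈ M.choice hγ T ↔ z ∈ M.ofHospital (M.choice hγ T) (M.hosp z) := by
    intro T
    simp [ofHospital]
  by_cases hzx : M.hosp z = M.hosp x
  · simp [ofHospital, hzx]
  · rw [Finset.mem_union, Finset.mem_filter, hz (insert x _), hz S.proposed, ofHospital_choice _ _ _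
      (M.hosp z), ofHospital_choice _ _ _ (M.hosp z), ← heaviestBasis_ofHospital _ _ (insert x _),
      ofHospital_insert_of_ne (Ne.symm hzx), heaviestBasis_ofHospital]
    simp [ofHospital, hzx]

/-- What holds throughout a run of deferred acceptance. -/
structure RunInvariant (M : Market D H X) (hγ : 0 < M.gamma) (P : M.Profile) (S : DAState H X) :
    Prop where
  toFinset_seq : ∀ h, (S.seq h).toFinset = M.ofHospital S.proposed h
  held : S.held = M.choice hγ S.proposed
  proposed : ∀ x ∈ S.proposed, P.Acc x ∧ ∀ y, P.Better y x → y ∈ S.proposed \ S.held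
  subset : ∀ R, P.lists.IsClosed (M.choice hγ) R → S.proposed ⊆ R

theorem runInvariant_daStart (hγ : 0 < M.gamma) : RunInvariant M hγ P daStart where
  toFinset_seq h := by simp [daStart, ofHospital]
  held := (Finset.subset_empty.1 (M.choice_subset hγ ∅)).symm
  proposed := by simp [daStart]
  subset := by simp [daStart]

theorem RunInvariant.greedyChoice_seq {hγ : 0 < M.gamma} {S : DAState H X}
    (hS : RunInvariant M hγ P S) (h : H) :
    M.greedyChoice h (S.seq h) = M.ofHospital S.held h := by
  rw [hS.held]
  exact greedyChoice_eq_ofHospital_choice (hS.toFinset_seq h)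

theorem RunInvariant.isIndep {hγ : 0 < M.gamma} {S : DAState H X}
    (hS : RunInvariant M hγ P S) (h : H) :
    M.IsIndep h (M.ofHospital S.held h) := by
  rw [hS.held, ofHospital_choice, ← matroid_indep (hγ := hγ)]
  exact (Matroid.isBasis_heaviestBasis (M.matroid_ground hγ h) M.priority_injective _).indep

theorem RunInvariant.held_subset {hγ : 0 < M.gamma} {S : DAState H X}
    (hS : RunInvariant M hγ P S) : S.held ⊆ S.proposed :=
  hS.held ▸ M.choice_subset hγ _

theorem RunInvariant.injOn {hγ : 0 < M.gamma} {S : DAState H X}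
    (hS : RunInvariant M hγ P S) : Set.InjOn M.doc (S.held : Set X) := by
  intro y hy z hz hyz
  by_contra hne
  rcases P.better_total hyz hne with h | h
  · exact (Finset.mem_sdiff.1 ((hS.proposed z (hS.held_subset hz)).2 y h)).2 hy
  · exact (Finset.mem_sdiff.1 ((hS.proposed y (hS.held_subset hy)).2 z h)).2 hz

theorem RunInvariant.next_held {hγ : 0 < M.gamma} {S : DAState H X}
    (hS : RunInvariant M hγ P S) (x : X) :
    (S.next M M.greedyChoice x).held = M.greedyStep (M.hosp x) (M.ofHospital S.held (M.hosp x)) x ∪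
      S.held.filter (fun y => M.hosp y ≠ M.hosp x) := by
  rw [← hS.greedyChoice_seq]
  simp [DAState.next, greedyChoice]

theorem RunInvariant.next_held_of_isIndep {hγ : 0 < M.gamma}
    {S : DAState H X} (hS : RunInvariant M hγ P S) {x : X}
    (hY : M.IsIndep (M.hosp x) (M.ofHospital (insert x S.held) (M.hosp x))) :
    (S.next M M.greedyChoice x).held = insert x S.held := by
  rw [ofHospital_insert_self] at hY
  rw [hS.next_held, greedyStep_of_isIndep hY, Finset.insert_union, ofHospital,
    Finset.filter_union_filter_not_eq]

theorem RunInvariant.next_held_of_isDiscarded {hγ : 0 < M.gamma}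
    {S : DAState H X} (hS : RunInvariant M hγ P S) {x a : X}
    (hY : ¬ M.IsIndep (M.hosp x) (M.ofHospital (insert x S.held) (M.hosp x)))
    (ha : M.IsDiscarded (M.hosp x) (M.ofHospital (insert x S.held) (M.hosp x)) a) :
    (S.next M M.greedyChoice x).held = (insert x S.held).erase a := by
  have hah : M.hosp a = M.hosp x := (Finset.mem_filter.1 ha.1).2
  rw [ofHospital_insert_self] at hY ha
  rw [hS.next_held, greedyStep_of_isDiscarded hY ha]
  ext z
  simp only [ofHospital, Finset.mem_union, Finset.mem_erase, Finset.mem_insert, Finset.mem_filter]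
  constructor
  · rintro (⟨h₁, h₂ | h₂⟩ | h₂)
    · exact ⟨h₁, Or.inl h₂⟩
    · exact ⟨h₁, Or.inr h₂.1⟩
    · exact ⟨fun h => h₂.2 (h ▸ hah), Or.inr h₂.1⟩
  · rintro ⟨h₁, h₂ | h₂⟩
    · exact Or.inl ⟨h₁, Or.inl h₂⟩
    · by_cases hz : M.hosp z = M.hosp x
      · exact Or.inl ⟨h₁, Or.inr ⟨h₂, hz⟩⟩
      · exact Or.inr ⟨h₂, hz⟩

variable [DecidableEq D] [Fintype X]

/-- A doctor who is free has been rejected by all hospitals to which she has made a proposal, so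
that everything preferred to her next proposal has been rejected. -/
theorem RunInvariant.mem_rejected {hγ : 0 < M.gamma} {S : DAState H X} (hS : RunInvariant M hγ P S)
    {x : X} (hfree : ∀ y ∈ S.held, M.doc y ≠ M.doc x) (hx : x ∈ M.nextProposal P S (M.doc x))
    {y : X} (hy : P.Better y x) : y ∈ S.proposed \ M.choice hγ S.proposed := by
  rw [← hS.held]
  refine Finset.mem_sdiff.2 ⟨?_, fun h => hfree y h hy.1⟩
  by_contra hn
  refine P.better_asymm hy ((mem_nextProposal.1 hx).2.2.2 y hn hy.1 ?_)
  rintro rfl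
  exact P.lists.irrefl y hy

theorem RunInvariant.next {hγ : 0 < M.gamma} {S T : DAState H X} (hS : RunInvariant M hγ P S)
    (h : M.DAStep M.greedyChoice P S T) : RunInvariant M hγ P T := by
  obtain ⟨x, hfree, hx, rfl⟩ := daStep_iff.1 h
  have hsub := M.choice_inter_subset hγ
  have hheld := held_next hS.toFinset_seq hS.held x
  have hrej := PrefLists.sdiff_choice_mono hsub (Finset.subset_insert x S.proposed)
  refine ⟨toFinset_seq_next hS.toFinset_seq x, hheld, fun z hz => ?_, fun R hR => ?_⟩
  · rw [hheld]
    rcases Finset.mem_insert.1 hz with rfl | hz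
    · exact ⟨(mem_nextProposal.1 hx).2.2.1, fun y hy => hrej (hS.mem_rejected hfree hx hy)⟩
    · refine ⟨(hS.proposed z hz).1, fun y hy => hrej ?_⟩
      rw [← hS.held]
      exact (hS.proposed z hz).2 y hy
  · exact Finset.insert_subset (hR x (mem_nextProposal.1 hx).2.2.1 fun y hy =>
      PrefLists.sdiff_choice_mono hsub (hS.subset R hR) (hS.mem_rejected hfree hx hy))
      (hS.subset R hR)

theorem runInvariant_of_reflTransGen (hγ : 0 < M.gamma) {S : DAState H X}
    (h : Relation.ReflTransGen (M.DAStep M.greedyChoice P) daStart S) : RunInvariant M hγ P S := by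
  induction h with
  | refl => exact runInvariant_daStart hγ
  | tail _ hstep ih => exact ih.next hstep

/-- Whatever doctors are picked, the set of proposals made is the least closed set. -/
theorem DAOutcome.exists_isLeastClosed (hγ : 0 < M.gamma) {A : Finset X}
    (hA : M.DAOutcome M.greedyChoice P A) :
    ∃ R, P.lists.IsLeastClosed (M.choice hγ) R ∧ A = M.choice hγ R := by
  obtain ⟨S, hS, hend, rfl⟩ := hA
  have hinv := runInvariant_of_reflTransGen hγ hS
  refine ⟨S.proposed, ⟨fun x hx hy => ?_, hinv.subset⟩, hinv.held⟩
  by_contra hxS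
  rw [← hinv.held] at hy
  obtain ⟨z, hz, hzx⟩ := not_isActive_iff.1 hend x (mem_nextProposal.2 ⟨rfl, hxS, hx, fun y hyS hyd
    hne => (P.better_total hyd hne).resolve_left fun h => hyS (Finset.mem_sdiff.1 (hy y h)).1⟩)
  have hzS : z ∈ S.proposed := M.choice_subset hγ _ (hinv.held ▸ hz)
  rcases P.better_total hzx (fun h => hxS (h ▸ hzS)) with h | h
  · exact (Finset.mem_sdiff.1 (hy z h)).2 hz
  · exact hxS (Finset.mem_sdiff.1 ((hinv.proposed z hzS).2 x h)).1

theorem strategyProof_greedyChoice [Fintype H] (M : Market D H X) (hγ : 0 < M.gamma) :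
    M.StrategyProof M.greedyChoice := by
  intro P Q d hPQ A B hA hB a b ha hb hba
  obtain ⟨R, hR, rfl⟩ := hA.exists_isLeastClosed hγ
  obtain ⟨R', hR', rfl⟩ := hB.exists_isLeastClosed hγ
  have hsub := M.choice_inter_subset hγ
  have hfix := fun {x} => hR.acc_and_rejected (x := x) hsub
  cases b with
  | none =>
    cases a with
    | none => exact P.pref_irrefl _ hba
    | some x =>
      have hx := (hfix (M.choice_subset hγ _ ha)).1
      exact P.pref_irrefl _ (P.pref_trans hba ((P.acc_iff x.2).2 hx))
  | some y =>
    obtain ⟨y, rfl⟩ := y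
    refine hR.not_mem_rejected hR' (M.choice_subset hγ) hsub (M.card_choice_mono hγ)
      (fun x hx => ?_) (fun z x hx => ?_) hb ?_
    · change P.pref _ _ _ ↔ Q.pref _ _ _
      rw [hPQ _ hx]
    · change (∃ _, P.pref _ _ _) ↔ ∃ _, Q.pref _ _ _
      rw [hPQ _ hx]
    · cases a with
      | none =>
        exact Finset.mem_sdiff.2 ⟨hR.1.mem hba fun z hz hzy => ha z hz hzy.1, fun h => ha y h rfl⟩
      | some x =>
        exact (hfix (M.choice_subset hγ _ ha)).2 y ((P.better_iff rfl x.2).1 hba)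

theorem DAOutcome.isStable [Nonempty X] (hD : 2 ≤ Fintype.card D) (hs : M.maxSize < 1)
    {A : Finset X} (hA : M.DAOutcome M.greedyChoice P A) : M.IsStable P (M.gamma : ℝ) A := by
  have hγ := M.gamma_pos hD hs
  obtain ⟨R, hR, rfl⟩ := hA.exists_isLeastClosed hγ
  have hinj := hR.injOn (M.choice_subset hγ) (M.choice_inter_subset hγ)
  refine ⟨⟨fun d => ?_, fun h => ?_⟩, ?_⟩
  · refine Finset.card_le_one.2 fun x hx y hy => ?_
    rw [ofDoctor, Finset.mem_filter] at hx hy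
    exact hinj hx.1 hy.1 (hx.2.trans hy.2.symm)
  · refine IsIndep.totalSize_le_one (h := h) hD hs ?_ ?_
    · rw [ofHospital_choice, ← matroid_indep (hγ := hγ)]
      exact (Matroid.isBasis_heaviestBasis (M.matroid_ground hγ h) M.priority_injective R).indep
    · refine (Finset.card_le_card (Finset.filter_subset _ _)).trans ?_
      rw [← Finset.card_image_of_injOn hinj]
      exact Finset.card_le_univ _
  · rintro ⟨h, B, hB, hBh, hpref, hlt⟩
    have hBR : B ⊆ R := by
      intro x hx
      by_cases hxA : x ∈ M.choice hγ R
      · exact M.choice_subset hγ R hxA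
      · by_cases hz : ∃ z ∈ M.choice hγ R, M.doc z = M.doc x
        · obtain ⟨z, hz, hzx⟩ := hz
          have := (P.better_iff rfl hzx).1 (hpref x hx hxA (some ⟨z, hzx⟩) hz)
          exact (Finset.mem_sdiff.1 ((hR.acc_and_rejected (M.choice_inter_subset hγ)
            (M.choice_subset hγ R hz)).2 x this)).1
        · push Not at hz
          exact hR.1.mem (hpref x hx hxA none hz) fun y hy hyx => hz y hy hyx.1
    have hsize := hB.2 h
    rw [ofHospital, Finset.filter_true_of_mem hBh] at hsize
    rw [ofHospital_choice] at hlt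
    exact hlt.not_ge (totalUtil_le_gamma_mul hγ hBR hBh hsize)

end Outcome

end Market

/-! ### Reasoning about programs of the random access machine -/

namespace RealRAM

@[simp] theorem Store.nat_setNat (σ : Store) (i v j : ℕ) :
    (σ.setNat i v).nat j = if j = i then v else σ.nat j :=
  Function.update_apply _ _ _ _

@[simp] theorem Store.real_setNat (σ : Store) (i v : ℕ) : (σ.setNat i v).real = σ.real := rfl

@[simp] theorem Store.natArr_setNat (σ : Store) (i v : ℕ) : (σ.setNat i v).natArr = σ.natArr := rfl

@[simp] theorem Store.realArr_setNat (σ : Store) (i v : ℕ) :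
    (σ.setNat i v).realArr = σ.realArr := rfl

@[simp] theorem Store.real_setReal (σ : Store) (i : ℕ) (v : ℝ) (j : ℕ) :
    (σ.setReal i v).real j = if j = i then v else σ.real j :=
  Function.update_apply _ _ _ _

@[simp] theorem Store.nat_setReal (σ : Store) (i : ℕ) (v : ℝ) : (σ.setReal i v).nat = σ.nat := rfl

@[simp] theorem Store.natArr_setReal (σ : Store) (i : ℕ) (v : ℝ) :
    (σ.setReal i v).natArr = σ.natArr := rfl

@[simp] theorem Store.natArr_setNatArr (σ : Store) (a j v b l : ℕ) :
    (σ.setNatArr a j v).natArr b l = if b = a ∧ l = j then v else σ.natArr b l := by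
  by_cases hb : b = a
  · subst hb
    simp [Store.setNatArr, Function.update_apply]
  · simp [Store.setNatArr, hb]

@[simp] theorem Store.nat_setNatArr (σ : Store) (a j v : ℕ) :
    (σ.setNatArr a j v).nat = σ.nat := rfl

@[simp] theorem Test.holds_eq {i j : ℕ} {σ : Store} :
    (Test.eq i j).Holds σ ↔ σ.nat i = σ.nat j := Iff.rfl

@[simp] theorem Test.holds_lt {i j : ℕ} {σ : Store} :
    (Test.lt i j).Holds σ ↔ σ.nat i < σ.nat j := Iff.rfl

@[simp] theorem Test.holds_rlt {i j : ℕ} {σ : Store} :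
    (Test.rlt i j).Holds σ ↔ σ.real i < σ.real j := Iff.rfl

/-- The natural number register that an instruction may change. -/
def Instr.natWrites : Instr → List ℕ
  | .const i _ | .move i _ | .add i _ _ | .sub i _ _ | .load i _ _ => [i]
  | _ => []

/-- The real number register that an instruction may change. -/
def Instr.realWrites : Instr → List ℕ
  | .rcast i _ | .rmove i _ | .radd i _ _ | .rsub i _ _ | .rmul i _ _ | .rdiv i _ _ | .rlog i _
  | .rceil i _ | .rload i _ _ => [i]
  | _ => []

/-- The natural number array that an instruction may change. -/
def Instr.natArrWrites : Instr → List ℕ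
  | .put a _ _ => [a]
  | _ => []

/-- The real number array that an instruction may change. -/
def Instr.realArrWrites : Instr → List ℕ
  | .rput a _ _ => [a]
  | _ => []

/-- The union over all instructions in the text of a program. -/
def Prog.collect (f : Instr → List ℕ) : Prog → List ℕ
  | .skip => []
  | .instr c => f c
  | .seq p q | .ite _ p q => p.collect f ++ q.collect f
  | .loop _ p => p.collect f

/-- The stores `σ` and `τ` differ at most in those registers and arrays that occur as destinations
in the text of `p`. -/
structure Frame (p : Prog) (σ τ : Store) : Prop where
  nat : ∀ i, i ∉ p.collect Instr.natWrites → τ.nat i = σ.nat i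
  real : ∀ i, i ∉ p.collect Instr.realWrites → τ.real i = σ.real i
  natArr : ∀ a, a ∉ p.collect Instr.natArrWrites → τ.natArr a = σ.natArr a
  realArr : ∀ a, a ∉ p.collect Instr.realArrWrites → τ.realArr a = σ.realArr a

theorem Frame.refl (p : Prog) (σ : Store) : Frame p σ σ :=
  ⟨fun _ _ => rfl, fun _ _ => rfl, fun _ _ => rfl, fun _ _ => rfl⟩

theorem Frame.trans {p : Prog} {σ τ ρ : Store} (h₁ : Frame p σ τ) (h₂ : Frame p τ ρ) :
    Frame p σ ρ :=
  ⟨fun i hi => (h₂.nat i hi).trans (h₁.nat i hi), fun i hi => (h₂.real i hi).trans (h₁.real i hi),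
    fun a ha => (h₂.natArr a ha).trans (h₁.natArr a ha),
    fun a ha => (h₂.realArr a ha).trans (h₁.realArr a ha)⟩

theorem Frame.mono {p q : Prog} {σ τ : Store} (h : Frame p σ τ)
    (hpq : ∀ f, p.collect f ⊆ q.collect f) : Frame q σ τ :=
  ⟨fun i hi => h.nat i fun h => hi (hpq _ h), fun i hi => h.real i fun h => hi (hpq _ h),
    fun a ha => h.natArr a fun h => ha (hpq _ h), fun a ha => h.realArr a fun h => ha (hpq _ h)⟩

theorem Instr.frame (c : Instr) (σ : Store) : Frame (.instr c) σ (c.apply σ) := by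
  cases c <;>
  · constructor <;> intro i hi <;>
      simp_all [Prog.collect, Instr.natWrites, Instr.realWrites, Instr.natArrWrites,
        Instr.realArrWrites, Instr.apply, Store.setNat, Store.setReal, Store.setNatArr,
        Store.setRealArr]

theorem Exec.frame {p : Prog} {σ τ : Store} {n : ℕ} (h : Exec p σ τ n) : Frame p σ τ := by
  induction h with
  | skip σ => exact Frame.refl _ _
  | instr c σ => exact c.frame σ
  | seq _ _ ihp ihq =>
    exact (ihp.mono fun f => by simp [Prog.collect]).trans
      (ihq.mono fun f => by simp [Prog.collect])
  | ite_true _ _ ih => exact ih.mono fun f => by simp [Prog.collect]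
  | ite_false _ _ ih => exact ih.mono fun f => by simp [Prog.collect]
  | loop_done _ => exact Frame.refl _ _
  | loop_next _ _ _ ihp ihl => exact (ihp.mono fun f => by simp [Prog.collect]).trans ihl

/-- Started in `σ`, the program `p` halts after at most `N` steps in a store that satisfies `Q`. -/
def Spec (p : Prog) (σ : Store) (N : ℕ) (Q : Store → Prop) : Prop :=
  ∃ τ n, Exec p σ τ n ∧ n ≤ N ∧ Q τ

theorem Spec.mono {p : Prog} {σ : Store} {N N' : ℕ} {Q Q' : Store → Prop} (h : Spec p σ N Q)
    (hN : N ≤ N') (hQ : ∀ τ, Frame p σ τ → Q τ → Q' τ) : Spec p σ N' Q' := by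
  obtain ⟨τ, n, he, hn, hq⟩ := h
  exact ⟨τ, n, he, hn.trans hN, hQ τ he.frame hq⟩

theorem Spec.skip {σ : Store} {N : ℕ} {Q : Store → Prop} (h : Q σ) (hN : 1 ≤ N) :
    Spec .skip σ N Q :=
  ⟨σ, 1, .skip σ, hN, h⟩

theorem Spec.seq {p q : Prog} {σ : Store} {N₁ N₂ N : ℕ} {Q Q' : Store → Prop}
    (hp : Spec p σ N₁ Q') (hq : ∀ τ, Frame p σ τ → Q' τ → Spec q τ N₂ Q) (hN : N₁ + N₂ ≤ N) :
    Spec (.seq p q) σ N Q := by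
  obtain ⟨τ, n, he, hn, h⟩ := hp
  obtain ⟨ρ, l, he', hl, h'⟩ := hq τ he.frame h
  exact ⟨ρ, n + l, .seq he he', by omega, h'⟩

theorem Spec.ite {b : Test} {p q : Prog} {σ : Store} {N : ℕ} {Q : Store → Prop}
    (hp : b.Holds σ → Spec p σ N Q) (hq : ¬ b.Holds σ → Spec q σ N Q) :
    Spec (.ite b p q) σ (N + 1) Q := by
  by_cases hb : b.Holds σ
  · obtain ⟨τ, n, he, hn, h⟩ := hp hb
    exact ⟨τ, n + 1, .ite_true hb he, by omega, h⟩
  · obtain ⟨τ, n, he, hn, h⟩ := hq hb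
    exact ⟨τ, n + 1, .ite_false hb he, by omega, h⟩

/-- The sequence of the instructions in `l`. -/
def block : List Instr → Prog
  | [] => .skip
  | c :: l => .seq (.instr c) (block l)

/-- The store after the instructions in `l`. -/
noncomputable def applyAll : List Instr → Store → Store
  | [], σ => σ
  | c :: l, σ => applyAll l (c.apply σ)

theorem Spec.block {l : List Instr} {σ : Store} {N : ℕ} {Q : Store → Prop} (h : Q (applyAll l σ))
    (hN : l.length + 1 ≤ N) : Spec (block l) σ N Q := by
  induction l generalizing σ N with
  | nil => exact Spec.skip h hN
  | cons c l ih =>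
    obtain ⟨N, rfl⟩ : ∃ N', N = 1 + N' := ⟨N - 1, by simp at hN; omega⟩
    exact Spec.seq ⟨_, 1, .instr c σ, le_rfl, rfl⟩ (Q' := fun τ => τ = c.apply σ)
      (fun τ _ hτ => hτ ▸ ih h (by simp at hN; omega)) le_rfl

theorem frame_block (l : List Instr) (σ : Store) : Frame (RealRAM.block l) σ (applyAll l σ) := by
  obtain ⟨_, _, he, _, rfl⟩ := Spec.block (l := l) (σ := σ) (Q := (· = applyAll l σ)) rfl le_rfl
  exact he.frame

theorem Spec.block_seq {l : List Instr} {q : Prog} {σ : Store} {N N' : ℕ} {Q : Store → Prop}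
    (h : Spec q (applyAll l σ) N Q) (hN : l.length + 1 + N ≤ N') :
    Spec (.seq (RealRAM.block l) q) σ N' Q :=
  Spec.seq (Q' := fun τ => τ = applyAll l σ) (Spec.block rfl le_rfl) (fun _ _ hτ => hτ ▸ h) hN

/-- `for i in [i, b)`, where the register 3 is meant to contain 1. -/
def forLoop (i b : ℕ) (p : Prog) : Prog :=
  .loop (.lt i b) (.seq p (block [.add i i 3]))

/-- The rule for loops with an invariant `I`, which takes the value of the counter. The body takes at
most `c` steps, and it may use that everything outside the destinations of the loop is as at the
start. -/
theorem Spec.forLoop {i b : ℕ} {p : Prog} {σ : Store} {s B c : ℕ} {N : ℕ} (I : ℕ → Store → Prop)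
    (hb : σ.nat b = B) (h₃ : σ.nat 3 = 1) (hs : σ.nat i = s) (hsB : s ≤ B)
    (hi : i ∉ p.collect Instr.natWrites) (hbp : b ∉ i :: p.collect Instr.natWrites)
    (h₃p : 3 ∉ i :: p.collect Instr.natWrites)
    (hI : I s σ)
    (hstep : ∀ j τ, s ≤ j → j < B → Frame (forLoop i b p) σ τ → τ.nat i = j → I j τ →
      Spec p τ c fun ρ => I (j + 1) (ρ.setNat i (j + 1)))
    (hN : (c + 3) * (B - s) + 1 ≤ N) : Spec (forLoop i b p) σ N (I B) := by
  have hcol : (RealRAM.forLoop i b p).collect Instr.natWrites =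
      p.collect Instr.natWrites ++ [i] := by
    simp [RealRAM.forLoop, RealRAM.block, Prog.collect, Instr.natWrites]
  have hb' : b ∉ (RealRAM.forLoop i b p).collect Instr.natWrites := by
    rw [hcol]; simp at hbp ⊢; tauto
  have h₃' : 3 ∉ (RealRAM.forLoop i b p).collect Instr.natWrites := by
    rw [hcol]; simp at h₃p ⊢; tauto
  have key : ∀ k j τ, j + k = B → s ≤ j → Frame (RealRAM.forLoop i b p) σ τ → τ.nat i = j →
      I j τ → Spec (RealRAM.forLoop i b p) τ ((c + 3) * k + 1) (I B) := by
    intro k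
    induction k with
    | zero =>
      intro j τ hj _ hf hij hIj
      obtain rfl : j = B := hj
      refine ⟨τ, 1, .loop_done ?_, le_add_self, hIj⟩
      rw [Test.holds_lt, hf.nat b hb', hb, hij]
      exact lt_irrefl _
    | succ k ih =>
      intro j τ hj hsj hf hij hIj
      have hbody : Spec (.seq p (RealRAM.block [.add i i 3])) τ (c + 2)
          fun ρ => ρ.nat i = j + 1 ∧ I (j + 1) ρ := by
        refine Spec.seq (hstep j τ hsj (by omega) hf hij hIj) (fun ρ hρ hIρ => ?_)
          (Nat.add_le_add_left (le_refl 2) c)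
        refine Spec.block ?_ le_rfl
        have h₁ : ρ.nat i = j := (hρ.nat i hi).trans hij
        have h₂ : ρ.nat 3 = 1 := by
          rw [hρ.nat 3 (fun h => h₃p (List.mem_cons_of_mem _ h)), hf.nat 3 h₃', h₃]
        simp only [applyAll, Instr.apply, h₁, h₂]
        exact ⟨by simp, hIρ⟩
      obtain ⟨ρ, n, he, hn, h⟩ := hbody
      obtain ⟨ρ', n', he', hn', h'⟩ := ih (j + 1) ρ (by omega) (by omega)
        (hf.trans (he.frame.mono fun f => by simp [RealRAM.forLoop, Prog.collect])) h.1 h.2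
      refine ⟨ρ', n + n' + 1, .loop_next ?_ he he', ?_, h'⟩
      · rw [Test.holds_lt, hf.nat b hb', hb, hij]
        omega
      · rw [Nat.mul_succ]
        omega
  obtain ⟨τ, n, he, hn, h⟩ := key (B - s) s σ (by omega) le_rfl (Frame.refl _ _) hs hI
  exact ⟨τ, n, he, hn.trans hN, h⟩

/-- A loop after the instructions `l`, which initialize its counter. -/
theorem Spec.block_forLoop {l : List Instr} {i b : ℕ} {p : Prog} {σ : Store} {s B c : ℕ} {N : ℕ}
    (I : ℕ → Store → Prop) (hb : σ.nat b = B) (h₃ : σ.nat 3 = 1) (hs : (applyAll l σ).nat i = s)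
    (hsB : s ≤ B) (hi : i ∉ p.collect Instr.natWrites)
    (hbp : b ∉ (Prog.seq (RealRAM.block l) (RealRAM.forLoop i b p)).collect Instr.natWrites)
    (h₃p : 3 ∉ (Prog.seq (RealRAM.block l) (RealRAM.forLoop i b p)).collect Instr.natWrites)
    (hI : I s (applyAll l σ))
    (hstep : ∀ j τ, s ≤ j → j < B →
      Frame (.seq (RealRAM.block l) (RealRAM.forLoop i b p)) σ τ → τ.nat i = j → I j τ →
      Spec p τ c fun ρ => I (j + 1) (ρ.setNat i (j + 1)))
    (hN : l.length + 1 + ((c + 3) * (B - s) + 1) ≤ N) :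
    Spec (.seq (RealRAM.block l) (RealRAM.forLoop i b p)) σ N (I B) := by
  have hcol : (RealRAM.forLoop i b p).collect Instr.natWrites =
      p.collect Instr.natWrites ++ [i] := by
    simp [RealRAM.forLoop, RealRAM.block, Prog.collect, Instr.natWrites]
  have hl := frame_block l σ
  simp only [Prog.collect, hcol, List.mem_append, List.mem_singleton, not_or] at hbp h₃p
  refine Spec.block_seq (Spec.forLoop I ((hl.nat b hbp.1).trans hb) ((hl.nat 3 h₃p.1).trans h₃) hs
    hsB hi ?_ ?_ hI (fun j τ h₁ h₂ hf => hstep j τ h₁ h₂ ?_) le_rfl) hN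
  · simp only [List.mem_cons, not_or]
    exact ⟨hbp.2.2, hbp.2.1⟩
  · simp only [List.mem_cons, not_or]
    exact ⟨h₃p.2.2, h₃p.2.1⟩
  · exact (hl.mono fun f => by simp [Prog.collect]).trans (hf.mono fun f => by simp [Prog.collect])

end RealRAM

/-! ### The program -/

namespace DAProgram

open RealRAM

/-- The register 5 receives `min n m + 1`. -/
def boundProg : Prog :=
  .seq (block [.const 3 1]) (.seq (.ite (.lt 0 2) (block [.move 5 0]) (block [.move 5 2]))
    (block [.add 5 5 3]))

/-- The real register 0 receives the maximal size. -/
def maxProg : Prog :=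
  .seq (block [.const 6 0]) (forLoop 6 2
    (.seq (block [.rload 1 0 6]) (.ite (.rlt 0 1) (block [.rmove 0 1]) .skip)))

/-- The real register 3 receives `γ`, and the real register 2 receives 1. -/
def gammaProg : Prog :=
  block [.rcast 2 3, .rcast 3 0, .rsub 3 3 2, .rlog 3 3, .radd 3 2 3, .rsub 4 2 0, .rdiv 3 3 4,
    .rceil 3 3]

/-- The natural number array 6 receives the levels. -/
def levelProg : Prog :=
  .seq (block [.const 6 0]) (forLoop 6 2
    (.seq (block [.rload 1 0 6, .const 7 1, .const 8 1])
      (.seq (forLoop 7 5 (.seq (block [.rcast 4 7, .rmul 4 4 3, .rdiv 4 2 4])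
          (.ite (.rlt 4 1) .skip (block [.add 8 7 3]))))
        (block [.put 6 6 8]))))

/-- The register 9 tells whether there is a next proposal, and the register 14 receives it. The
array 4 counts the proposals made by each doctor, and the array 5 tells who holds a contract. -/
def findProg : Prog :=
  .seq (block [.const 9 0, .const 6 0]) (forLoop 6 2
    (.seq (block [.load 10 0 6, .load 11 4 10, .add 11 11 3, .load 12 2 6, .load 13 5 10])
      (.ite (.eq 11 12) (.ite (.eq 13 4) (block [.move 9 3, .move 14 6]) .skip) .skip)))

/-- The proposal in the register 14 is tentatively accepted; its hospital goes to the register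
15. -/
def acceptProg : Prog :=
  block [.load 10 0 14, .load 11 4 10, .add 11 11 3, .put 4 10 11, .put 5 10 3, .put 3 14 3,
    .load 15 1 14]

/-- The array 7 is cleared. -/
def clearProg : Prog :=
  .seq (block [.const 7 0]) (forLoop 7 5 (block [.put 7 7 4]))

/-- The array 7 receives the number of contracts of each level that the hospital in the register 15
holds. Contracts that are not large at any level are counted beyond the cells that are read. -/
def countProg : Prog :=
  .seq (block [.const 6 0]) (forLoop 6 2
    (.seq (block [.load 12 3 6]) (.ite (.eq 12 3)
      (.seq (block [.load 12 1 6]) (.ite (.eq 12 15)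
        (block [.load 12 6 6, .load 13 7 12, .add 13 13 3, .put 7 12 13]) .skip)) .skip)))

/-- The register 17 receives the first level whose bound is violated, or 0. -/
def scanProg : Prog :=
  .seq (block [.const 16 0, .const 17 0, .const 7 1]) (forLoop 7 5
    (.seq (block [.load 12 7 7, .add 16 16 12])
      (.ite (.lt 7 16) (.ite (.eq 17 4) (block [.move 17 7]) .skip) .skip)))

/-- The register 19 receives the contract that is to be discarded. The search starts from the new
contract, which is always among the candidates. -/
def selectProg : Prog :=
  .seq (block [.const 6 0, .move 19 14, .rload 6 1 14]) (forLoop 6 2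
    (.seq (block [.load 12 3 6]) (.ite (.eq 12 3)
      (.seq (block [.load 12 1 6, .load 13 6 6, .rload 5 1 6]) (.ite (.eq 12 15)
        (.ite (.lt 17 13) .skip
          (.ite (.rlt 5 6) (block [.move 19 6, .rmove 6 5])
            (.ite (.rlt 6 5) .skip (.ite (.lt 6 19) (block [.move 19 6]) .skip)))) .skip)) .skip)))

/-- The contract in the register 19 is discarded. -/
def discardProg : Prog :=
  block [.put 3 19 4, .load 10 0 19, .put 5 10 4]

/-- The hospital treats the new proposal. -/
def proposeProg : Prog :=
  .seq acceptProg (.seq clearProg (.seq countProg (.seq scanProg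
    (.ite (.eq 17 4) .skip (.seq selectProg discardProg)))))

/-- Deferred acceptance. -/
def mainLoop : Prog :=
  .loop (.eq 9 3) (.seq findProg (.ite (.eq 9 3) proposeProg .skip))

/-- The whole program. The input occupies the registers 0, 1, 2, the arrays 0, 1, 2 and the real
arrays 0, 1. The registers 3 and 4 contain 1 and 0, the register 5 contains `min n m + 1`, and the
real register 3 contains `γ`. The arrays 3, 4, 5 describe the state of deferred acceptance: the
contracts held, the number of proposals of each doctor, and who is matched. The array 6 contains
the levels, and the array 7 counts contracts by level. -/
def prog : Prog :=
  .seq boundProg (.seq maxProg (.seq gammaProg (.seq levelProg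
    (.seq (block [.const 9 1]) mainLoop))))

variable {n k m : ℕ}

/-- What the store contains during the main loop and does not change: the input, and the level
`lev x` of every contract `x`, which is the first level `t ≤ T` at which `x` is large. -/
structure Env (M : Market (Fin n) (Fin k) (Fin m)) (P : M.Profile) (lev : Fin m → ℕ) (T : ℕ)
    (σ : Store) : Prop where
  nat_two : σ.nat 2 = m
  nat_three : σ.nat 3 = 1
  nat_four : σ.nat 4 = 0
  nat_five : σ.nat 5 = T + 1
  doc : ∀ x : Fin m, σ.natArr 0 x = M.doc x
  hosp : ∀ x : Fin m, σ.natArr 1 x = M.hosp x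
  pos : ∀ x : Fin m, σ.natArr 2 x = M.listPosition P x
  level : ∀ x : Fin m, σ.natArr 6 x = lev x
  util : ∀ x : Fin m, σ.realArr 1 x = M.util x

variable {M : Market (Fin n) (Fin k) (Fin m)} {P : M.Profile} {lev : Fin m → ℕ} {T : ℕ}
  {σ τ : Store}

theorem Env.frame (h : Env M P lev T σ) {p : Prog} (hf : Frame p σ τ)
    (hp : (∀ i ∈ [2, 3, 4, 5], i ∉ p.collect Instr.natWrites) ∧
      (∀ a ∈ [0, 1, 2, 6], a ∉ p.collect Instr.natArrWrites) ∧
      1 ∉ p.collect Instr.realArrWrites) : Env M P lev T τ := by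
  obtain ⟨h₁, h₂, h₃⟩ := hp
  simp only [List.mem_cons, List.not_mem_nil, or_false, forall_eq_or_imp, forall_eq] at h₁ h₂
  constructor
  · rw [hf.nat 2 h₁.1, h.nat_two]
  · rw [hf.nat 3 h₁.2.1, h.nat_three]
  · rw [hf.nat 4 h₁.2.2.1, h.nat_four]
  · rw [hf.nat 5 h₁.2.2.2, h.nat_five]
  · rw [hf.natArr 0 h₂.1]; exact h.doc
  · rw [hf.natArr 1 h₂.2.1]; exact h.hosp
  · rw [hf.natArr 2 h₂.2.2.1]; exact h.pos
  · rw [hf.natArr 6 h₂.2.2.2]; exact h.level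
  · rw [hf.realArr 1 h₃]; exact h.util

/-- The array 3 holds the indicator function of `A`. -/
def Holds (σ : Store) (A : Finset (Fin m)) : Prop :=
  ∀ x : Fin m, σ.natArr 3 x = if x ∈ A then 1 else 0

theorem spec_clearProg (hE : Env M P lev T σ) :
    Spec clearProg σ (5 * T + 8) fun τ => ∀ t ≤ T, τ.natArr 7 t = 0 := by
  refine (Spec.block_forLoop (s := 0) (c := 2) (fun j τ => ∀ t < j, τ.natArr 7 t = 0)
    hE.nat_five hE.nat_three ?_ (Nat.zero_le _) (by decide) (by decide) (by decide) (by simp) ?_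
    (by simp; omega)).mono le_rfl fun τ _ h t ht => h t (Nat.lt_succ_of_le ht)
  · simp [applyAll, Instr.apply]
  · intro j τ _ hj hf hij hI
    refine Spec.block ?_ le_rfl
    have h₄ := (hE.frame hf (by decide)).nat_four
    intro t ht
    simp only [applyAll, Instr.apply, Store.natArr_setNat, Store.natArr_setNatArr, h₄, hij,
      true_and]
    split_ifs with h
    · rfl
    · exact hI t (by omega)

theorem card_filter_lt_succ {Y : Finset (Fin m)} {p : Fin m → Prop} [DecidablePred p] {j : ℕ}
    (hj : j < m) : (Y.filter fun x : Fin m => (x : ℕ) < j + 1 ∧ p x).card =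
      (Y.filter fun x : Fin m => (x : ℕ) < j ∧ p x).card +
        if (⟨j, hj⟩ : Fin m) ∈ Y ∧ p ⟨j, hj⟩ then 1 else 0 := by
  split_ifs with h
  · rw [← Finset.card_insert_of_notMem (a := (⟨j, hj⟩ : Fin m)) (by simp)]
    congr 1
    ext x
    simp only [Finset.mem_filter, Finset.mem_insert, Fin.ext_iff]
    constructor
    · rintro ⟨h₁, h₂, h₃⟩
      by_cases hx : (x : ℕ) = j
      · exact Or.inl hx
      · exact Or.inr ⟨h₁, by omega, h₃⟩
    · rintro (h' | ⟨h₁, h₂, h₃⟩)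
      · obtain rfl : x = ⟨j, hj⟩ := Fin.ext h'
        exact ⟨h.1, by simp, h.2⟩
      · exact ⟨h₁, by omega, h₃⟩
  · rw [add_zero]
    congr 1
    ext x
    simp only [Finset.mem_filter]
    refine and_congr_right fun hx => and_congr_left fun hpx => ⟨fun hlt => ?_, fun hlt => by omega⟩
    refine (Nat.lt_succ_iff.1 hlt).lt_of_ne fun heq => h ?_
    obtain rfl : x = ⟨j, hj⟩ := Fin.ext heq
    exact ⟨hx, hpx⟩

theorem spec_countProg (hE : Env M P lev T σ) {A : Finset (Fin m)} (hA : Holds σ A) {h : Fin k}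
    (hh : σ.nat 15 = h) (hclear : ∀ t ≤ T, σ.natArr 7 t = 0) :
    Spec countProg σ (15 * m + 3) fun τ =>
      ∀ t ≤ T, τ.natArr 7 t = ((M.ofHospital A h).filter fun x => lev x = t).card := by
  refine (Spec.block_forLoop (s := 0) (c := 12) (fun j τ => ∀ t ≤ T, τ.natArr 7 t =
    ((M.ofHospital A h).filter fun x : Fin m => (x : ℕ) < j ∧ lev x = t).card)
    hE.nat_two hE.nat_three ?_ (Nat.zero_le _) (by decide) (by decide) (by decide) ?_ ?_
    (by simp; omega)).mono le_rfl fun τ _ h t ht => ?_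
  · simp [applyAll, Instr.apply]
  · simpa [applyAll, Instr.apply] using hclear
  · intro j τ _ hj hf hij hI
    have hE' := hE.frame hf (by decide)
    have h₁₅ : τ.nat 15 = h := by
      rw [hf.nat 15 (by decide), hh]
    have h₁ : τ.natArr 1 j = M.hosp ⟨j, hj⟩ := hE'.hosp ⟨j, hj⟩
    have h₃ : τ.natArr 3 j = if (⟨j, hj⟩ : Fin m) ∈ A then 1 else 0 := by
      rw [hf.natArr 3 (by decide)]; exact hA ⟨j, hj⟩
    have h₆ : τ.natArr 6 j = lev ⟨j, hj⟩ := hE'.level ⟨j, hj⟩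
    have hone := hE'.nat_three
    have hskip : ⟨j, hj⟩ ∉ M.ofHospital A h → ∀ t ≤ T, τ.natArr 7 t =
        ((M.ofHospital A h).filter fun x : Fin m => (x : ℕ) < j + 1 ∧ lev x = t).card := by
      intro hn t ht
      rw [card_filter_lt_succ hj, if_neg (fun h => hn h.1), hI t ht, add_zero]
    refine Spec.block_seq (N := 10) (Spec.ite (fun hb => Spec.block_seq (N := 7) (Spec.ite
      (fun hb' => Spec.block ?_ (by simp)) fun hb' => Spec.skip ?_ (by simp)) (by simp))
      fun hb => Spec.skip ?_ (by simp)) (by simp)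
    · simp [applyAll, Instr.apply, hij, h₁, h₃, h₆, h₁₅, hone,
        -Order.lt_add_one_iff] at hb hb' ⊢
      intro t ht
      have hx : (⟨j, hj⟩ : Fin m) ∈ M.ofHospital A h :=
        Finset.mem_filter.2 ⟨hb, Fin.ext hb'⟩
      rw [card_filter_lt_succ hj]
      split_ifs with h' h'' h''
      · rw [← h', hI t ht]
      · exact absurd ⟨hx, h'.symm⟩ h''
      · exact absurd h''.2.symm h'
      · exact hI t ht
    · simp [applyAll, Instr.apply, hij, h₁, h₁₅] at hb' ⊢
      simpa using hskip fun hx => hb' (congrArg _ (Finset.mem_filter.1 hx).2)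
    · simp [applyAll, Instr.apply, hij, h₃, hone] at hb ⊢
      simpa using hskip fun hx => hb (Finset.mem_filter.1 hx).1
  · rw [h t ht]
    congr 1
    ext x
    simp

/-- As long as no violation has been found, the number of contracts up to the current level is
accumulated in the register 16. -/
theorem spec_scanProg (hE : Env M P lev T σ) (hlev : ∀ x, 1 ≤ lev x) {Y : Finset (Fin m)}
    (hY : ∀ t ≤ T, σ.natArr 7 t = (Y.filter fun x => lev x = t).card) :
    Spec scanProg σ (10 * T + 15) fun τ =>
      (τ.nat 17 = 0 ∧ ∀ s, 1 ≤ s → s ≤ T → (Y.filter fun x => lev x ≤ s).card ≤ s) ∨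
      (1 ≤ τ.nat 17 ∧ τ.nat 17 ≤ T ∧ τ.nat 17 < (Y.filter fun x => lev x ≤ τ.nat 17).card ∧
        ∀ s, 1 ≤ s → s < τ.nat 17 → (Y.filter fun x => lev x ≤ s).card ≤ s) := by
  refine (Spec.block_forLoop (s := 1) (c := 7) (fun j τ =>
    τ.nat 16 = (Y.filter fun x => lev x < j).card ∧
      ((τ.nat 17 = 0 ∧ ∀ s, 1 ≤ s → s < j → (Y.filter fun x => lev x ≤ s).card ≤ s) ∨
      (1 ≤ τ.nat 17 ∧ τ.nat 17 < j ∧ τ.nat 17 < (Y.filter fun x => lev x ≤ τ.nat 17).card ∧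
        ∀ s, 1 ≤ s → s < τ.nat 17 → (Y.filter fun x => lev x ≤ s).card ≤ s)))
    hE.nat_five hE.nat_three ?_ (by omega) (by decide) (by decide) (by decide) ?_ ?_
    (by simp; omega)).mono le_rfl fun τ _ h => ?_
  · simp [applyAll, Instr.apply]
  · refine ⟨?_, Or.inl ⟨?_, fun s h₁ h₂ => by omega⟩⟩
    · rw [Finset.filter_eq_empty_iff.2 fun x _ => not_lt.2 (hlev x)]
      simp [applyAll, Instr.apply]
    · simp [applyAll, Instr.apply]
  · rintro j τ hj₁ hj hf hij ⟨h₁₆, h₁₇⟩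
    have hE' := hE.frame hf (by decide)
    have h₇ : τ.natArr 7 j = (Y.filter fun x => lev x = j).card := by
      rw [hf.natArr 7 (by decide)]; exact hY j (by omega)
    have hsum : (Y.filter fun x => lev x < j).card + (Y.filter fun x => lev x = j).card =
        (Y.filter fun x => lev x ≤ j).card := by
      rw [← Finset.card_union_of_disjoint, ← Finset.filter_or]
      · simp only [le_iff_lt_or_eq]
      · exact Finset.disjoint_filter.2 fun x _ h => h.ne
    have hsucc : (Y.filter fun x => lev x < j + 1).card = (Y.filter fun x => lev x ≤ j).card := by
      simp only [Nat.lt_succ_iff]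
    have hext : (Y.filter fun x => lev x ≤ j).card ≤ j →
        (∀ s, 1 ≤ s → s < j → (Y.filter fun x => lev x ≤ s).card ≤ s) →
        ∀ s, 1 ≤ s → s < j + 1 → (Y.filter fun x => lev x ≤ s).card ≤ s := by
      intro h h' s hs hs'
      rcases Nat.lt_succ_iff_lt_or_eq.1 hs' with hlt | rfl
      · exact h' s hs hlt
      · exact h
    rw [← h₁₆, ← h₇] at hsum
    have h₃ := hE'.nat_three
    have h₄ := hE'.nat_four
    refine Spec.block_seq (N := 4) (Spec.ite (fun hb => Spec.ite (fun hb' => Spec.block ?_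
      (by simp)) fun hb' => Spec.skip ?_ (by simp)) fun hb => Spec.skip ?_ (by simp)) (by simp)
    · simp [applyAll, Instr.apply, hij, h₄, hsum, -Order.lt_add_one_iff] at hb hb' ⊢
      rw [hb'] at h₁₇
      refine ⟨hsucc.symm, Or.inr ⟨hj₁, hb, ?_⟩⟩
      rcases h₁₇ with h | h
      · exact h.2
      · exact absurd h.1 (by omega)
    · simp [applyAll, Instr.apply, hij, h₄, hsum, -Order.lt_add_one_iff] at hb hb' ⊢
      refine ⟨hsucc.symm, Or.inr ?_⟩
      rcases h₁₇ with h | h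
      · exact absurd h.1 hb'
      · exact ⟨h.1, by omega, h.2.2⟩
    · simp [applyAll, Instr.apply, hij, hsum, -Order.lt_add_one_iff] at hb ⊢
      refine ⟨hsucc.symm, ?_⟩
      rcases h₁₇ with h | h
      · exact Or.inl ⟨h.1, hext hb h.2⟩
      · exact Or.inr ⟨h.1, by omega, h.2.2⟩
  · rcases h.2 with h | h
    · exact Or.inl ⟨h.1, fun s h₁ h₂ => h.2 s h₁ (by omega)⟩
    · exact Or.inr ⟨h.1, by omega, h.2.2⟩

theorem spec_selectProg (hE : Env M P lev T σ) {A : Finset (Fin m)} (hA : Holds σ A) {h : Fin k}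
    (hh : σ.nat 15 = h) {x : Fin m} (hx : σ.nat 14 = x) (hxA : x ∈ A) (hxh : M.hosp x = h) {v : ℕ}
    (hv : σ.nat 17 = v) (hxv : lev x ≤ v) :
    Spec selectProg σ (20 * m + 6) fun τ => ∃ a : Fin m, (a ∈ A ∧ M.hosp a = h ∧ lev a ≤ v) ∧
      τ.nat 19 = a ∧
      ∀ y ∈ A, M.hosp y = h → lev y ≤ v → M.priority a ≤ M.priority y := by
  refine (Spec.block_forLoop (s := 0) (c := 15) (fun j τ => ∃ a : Fin m,
    (a ∈ A ∧ M.hosp a = h ∧ lev a ≤ v) ∧ τ.nat 19 = a ∧ τ.real 6 = M.util a ∧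
      ∀ y ∈ A, M.hosp y = h → lev y ≤ v → (y : ℕ) < j → M.priority a ≤ M.priority y)
    hE.nat_two hE.nat_three ?_ (Nat.zero_le _) (by decide) (by decide) (by decide) ?_ ?_
    (by simp; omega)).mono le_rfl ?_
  · simp [applyAll, Instr.apply]
  · exact ⟨x, ⟨hxA, hxh, hxv⟩, by simp [applyAll, Instr.apply, hx],
      by simp [applyAll, Instr.apply, hx, hE.util], by simp⟩
  · rintro j τ - hj hf hij ⟨a, ha, h₁₉, hr₆, hmin⟩
    have hE' := hE.frame hf (by decide)
    have h₁₅ : τ.nat 15 = h := by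
      rw [hf.nat 15 (by decide), hh]
    have h₁₇ : τ.nat 17 = v := by
      rw [hf.nat 17 (by decide), hv]
    have h₁ : τ.natArr 1 j = M.hosp ⟨j, hj⟩ := hE'.hosp ⟨j, hj⟩
    have h₃ : τ.natArr 3 j = if (⟨j, hj⟩ : Fin m) ∈ A then 1 else 0 := by
      rw [hf.natArr 3 (by decide)]; exact hA ⟨j, hj⟩
    have h₆ : τ.natArr 6 j = lev ⟨j, hj⟩ := hE'.level ⟨j, hj⟩
    have hu : τ.realArr 1 j = M.util ⟨j, hj⟩ := hE'.util ⟨j, hj⟩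
    have hone := hE'.nat_three
    have hkeep : ((⟨j, hj⟩ : Fin m) ∈ A → M.hosp ⟨j, hj⟩ = h → lev ⟨j, hj⟩ ≤ v →
        M.priority a ≤ M.priority ⟨j, hj⟩) →
        ∀ y ∈ A, M.hosp y = h → lev y ≤ v → (y : ℕ) < j + 1 → M.priority a ≤ M.priority y := by
      intro h' y hyA hyh hyv hyj
      rcases Nat.lt_succ_iff_lt_or_eq.1 hyj with hlt | heq
      · exact hmin y hyA hyh hyv hlt
      · obtain rfl : y = ⟨j, hj⟩ := Fin.ext heq
        exact h' hyA hyh hyv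
    have hreplace : M.priority ⟨j, hj⟩ ≤ M.priority a →
        ∀ y ∈ A, M.hosp y = h → lev y ≤ v → (y : ℕ) < j + 1 →
          M.priority ⟨j, hj⟩ ≤ M.priority y := by
      intro h' y hyA hyh hyv hyj
      rcases Nat.lt_succ_iff_lt_or_eq.1 hyj with hlt | heq
      · exact h'.trans (hmin y hyA hyh hyv hlt)
      · exact le_of_eq (congrArg _ (Fin.ext heq.symm))
    refine Spec.block_seq (N := 13) (Spec.ite (fun hb => Spec.block_seq (N := 7) (Spec.ite
      (fun hb' => Spec.ite (fun hv' => Spec.skip ?_ (by simp)) fun hv' => Spec.ite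
        (fun hlt => Spec.block ?_ (by simp)) fun hlt => Spec.ite (fun hgt => Spec.skip ?_ (by simp))
        fun hgt => Spec.ite (fun hja => Spec.block ?_ (by simp)) fun hja => Spec.skip ?_ (by simp))
      fun hb' => Spec.skip ?_ (by simp)) (by simp)) fun hb => Spec.skip ?_ (by simp)) (by simp)
    · simp [applyAll, Instr.apply, hij, h₆, h₁₇, -Order.lt_add_one_iff] at hv' ⊢
      exact ⟨a, ha, h₁₉, hr₆, hkeep fun _ _ h => absurd hv' (not_lt.2 h)⟩
    · simp [applyAll, Instr.apply, hij, h₁, h₃, h₆, hu, h₁₅, h₁₇, hr₆, hone,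
        -Order.lt_add_one_iff] at hb hb' hv' hlt ⊢
      exact ⟨⟨j, hj⟩, ⟨hb, Fin.ext hb', hv'⟩, rfl, rfl,
        hreplace (Market.priority_le_iff.2 (Or.inl hlt))⟩
    · simp [applyAll, Instr.apply, hij, hu, hr₆, -Order.lt_add_one_iff] at hgt ⊢
      exact ⟨a, ha, h₁₉, rfl, hkeep fun _ _ _ => Market.priority_le_iff.2 (Or.inl hgt)⟩
    · simp [applyAll, Instr.apply, hij, h₁, h₃, h₆, hu, h₁₅, h₁₇, hr₆, h₁₉, hone,
        -Order.lt_add_one_iff] at hb hb' hv' hlt hgt hja ⊢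
      have heq : M.util ⟨j, hj⟩ = M.util a := le_antisymm hgt hlt
      exact ⟨⟨j, hj⟩, ⟨hb, Fin.ext hb', hv'⟩, rfl, heq.symm,
        hreplace (Market.priority_le_iff.2 (Or.inr ⟨heq, le_of_lt hja⟩))⟩
    · simp [applyAll, Instr.apply, hij, hu, hr₆, h₁₉, -Order.lt_add_one_iff] at hlt hgt hja ⊢
      exact ⟨a, ha, rfl, rfl, hkeep fun _ _ _ =>
        Market.priority_le_iff.2 (Or.inr ⟨le_antisymm hlt hgt, hja⟩)⟩
    · simp [applyAll, Instr.apply, hij, h₁, h₁₅, -Order.lt_add_one_iff] at hb' ⊢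
      exact ⟨a, ha, h₁₉, hr₆, hkeep fun _ h _ => absurd (congrArg _ h) hb'⟩
    · simp [applyAll, Instr.apply, hij, h₃, hone, -Order.lt_add_one_iff] at hb ⊢
      exact ⟨a, ha, h₁₉, hr₆, hkeep fun h => absurd h hb⟩
  · rintro τ - ⟨a, ha, h₁₉, -, hmin⟩
    exact ⟨a, ha, h₁₉, fun y hyA hyh hyv => hmin y hyA hyh hyv y.2⟩

/-- In terms of the store: the contract `x` is the next proposal of its doctor, who is free. -/
def IsNext (M : Market (Fin n) (Fin k) (Fin m)) (P : M.Profile) (σ : Store) (x : Fin m) : Prop :=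
  M.listPosition P x = σ.natArr 4 (M.doc x) + 1 ∧ σ.natArr 5 (M.doc x) = 0

theorem spec_findProg (hE : Env M P lev T σ) :
    Spec findProg σ (15 * m + 4) fun τ =>
      (τ.nat 9 = 0 ∧ ∀ x, ¬ IsNext M P σ x) ∨
      (τ.nat 9 = 1 ∧ ∃ x, IsNext M P σ x ∧ τ.nat 14 = x) := by
  refine (Spec.block_forLoop (s := 0) (c := 12) (fun j τ =>
      (τ.nat 9 = 0 ∧ ∀ x : Fin m, (x : ℕ) < j → ¬ IsNext M P σ x) ∨
      (τ.nat 9 = 1 ∧ ∃ x, IsNext M P σ x ∧ τ.nat 14 = x))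
    hE.nat_two hE.nat_three ?_ (Nat.zero_le _) (by decide) (by decide) (by decide) ?_ ?_
    (by simp; omega)).mono le_rfl ?_
  · simp [applyAll, Instr.apply]
  · exact Or.inl ⟨by simp [applyAll, Instr.apply], by simp⟩
  · intro j τ _ hj hf hij hI
    have hE' := hE.frame hf (by decide)
    have h₀ : τ.natArr 0 j = M.doc ⟨j, hj⟩ := hE'.doc ⟨j, hj⟩
    have h₂ : τ.natArr 2 j = M.listPosition P ⟨j, hj⟩ := hE'.pos ⟨j, hj⟩
    have hone := hE'.nat_three
    have hzero := hE'.nat_four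
    have hcount := hf.natArr 4 (by decide)
    have hbusy := hf.natArr 5 (by decide)
    have hkeep : ¬ IsNext M P σ ⟨j, hj⟩ →
        (τ.nat 9 = 0 ∧ ∀ x : Fin m, (x : ℕ) < j + 1 → ¬ IsNext M P σ x) ∨
        (τ.nat 9 = 1 ∧ ∃ x, IsNext M P σ x ∧ τ.nat 14 = x) := by
      refine fun hn => hI.imp (fun h => ⟨h.1, fun x hx => ?_⟩) id
      rcases Nat.lt_succ_iff_lt_or_eq.1 hx with hlt | heq
      · exact h.2 x hlt
      · obtain rfl : x = ⟨j, hj⟩ := Fin.ext heq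
        exact hn
    refine Spec.block_seq (N := 5) (Spec.ite (fun hb => Spec.ite (fun hb' => Spec.block ?_
      (by simp)) fun hb' => Spec.skip ?_ (by simp)) fun hb => Spec.skip ?_ (by simp)) (by simp)
    · simp [applyAll, Instr.apply, hij, h₀, h₂, hone, hzero, hcount, hbusy] at hb hb' ⊢
      exact ⟨⟨j, hj⟩, ⟨hb.symm, hb'⟩, rfl⟩
    · simp [applyAll, Instr.apply, hij, h₀, hzero, hbusy, -Order.lt_add_one_iff] at hb' ⊢
      exact hkeep fun h => hb' h.2
    · simp [applyAll, Instr.apply, hij, h₀, h₂, hone, hcount, -Order.lt_add_one_iff] at hb ⊢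
      exact hkeep fun h => hb h.1.symm
  · rintro τ - (h | h)
    · exact Or.inl ⟨h.1, fun x => h.2 x x.2⟩
    · exact Or.inr h

/-! ### The preparations -/

theorem spec_boundProg (h₀ : σ.nat 0 = n) (h₂ : σ.nat 2 = m) :
    Spec boundProg σ 8 fun τ => τ.nat 3 = 1 ∧ τ.nat 5 = min n m + 1 := by
  refine Spec.block_seq (N := 6) ?_ (by simp)
  refine Spec.seq (N₁ := 3) (N₂ := 2) (Q' := fun τ => τ.nat 3 = 1 ∧ τ.nat 5 = min n m)
    (Spec.ite (fun hb => Spec.block ?_ (by simp)) fun hb => Spec.block ?_ (by simp))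
    (fun τ _ h => Spec.block ?_ (by simp)) (by simp)
  · simp [applyAll, Instr.apply, h₀, h₂] at hb ⊢
    exact hb.le
  · simp [applyAll, Instr.apply, h₀, h₂] at hb ⊢
    exact hb
  · simp [applyAll, Instr.apply, h.1, h.2]

theorem spec_maxProg (hm : 0 < m) (h₂ : σ.nat 2 = m) (h₃ : σ.nat 3 = 1) (hr : σ.real 0 = 0)
    (hsize : ∀ x : Fin m, σ.realArr 0 x = M.size x) :
    Spec maxProg σ (10 * m + 3) fun τ => τ.real 0 = M.maxSize := by
  refine (Spec.block_forLoop (s := 0) (c := 6) (fun j τ =>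
      (∀ x : Fin m, (x : ℕ) < j → M.size x ≤ τ.real 0) ∧ τ.real 0 ≤ M.maxSize)
    h₂ h₃ ?_ (Nat.zero_le _) (by decide) (by decide) (by decide) ?_ ?_
    (by simp; omega)).mono le_rfl ?_
  · simp [applyAll, Instr.apply]
  · refine ⟨by simp, ?_⟩
    simp only [applyAll, Instr.apply, Store.real_setNat, hr]
    exact (M.size_nonneg ⟨0, hm⟩).trans (M.size_le_maxSize _)
  · rintro j τ - hj hf hij ⟨hmax, hle⟩
    have hx : τ.realArr 0 j = M.size ⟨j, hj⟩ := by
      rw [hf.realArr 0 (by decide)]; exact hsize ⟨j, hj⟩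
    refine Spec.block_seq (N := 3) (Spec.ite (fun hb => Spec.block ?_ (by simp))
      fun hb => Spec.skip ?_ (by simp)) (by simp)
    · simp [applyAll, Instr.apply, hij, hx, -Order.lt_add_one_iff] at hb ⊢
      refine ⟨fun x hxj => ?_, M.size_le_maxSize _⟩
      rcases Nat.lt_succ_iff_lt_or_eq.1 hxj with hlt | heq
      · exact (hmax x hlt).trans hb.le
      · exact le_of_eq (congrArg _ (Fin.ext heq))
    · simp [applyAll, Instr.apply, hij, hx, -Order.lt_add_one_iff] at hb ⊢
      refine ⟨fun x hxj => ?_, hle⟩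
      rcases Nat.lt_succ_iff_lt_or_eq.1 hxj with hlt | heq
      · exact hmax x hlt
      · obtain rfl : x = ⟨j, hj⟩ := Fin.ext heq
        exact hb
  · rintro τ - ⟨hmax, hle⟩
    have : Nonempty (Fin m) := ⟨⟨0, hm⟩⟩
    exact le_antisymm hle (ciSup_le fun x => hmax x x.2)

theorem spec_gammaProg (h₀ : σ.nat 0 = n) (h₃ : σ.nat 3 = 1) (hr : σ.real 0 = M.maxSize) :
    Spec gammaProg σ 9 fun τ => τ.real 2 = 1 ∧ τ.real 3 = (M.gamma : ℝ) := by
  refine Spec.block ?_ (by simp)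
  simp [applyAll, Instr.apply, h₀, h₃, hr, Market.gamma]

/-- The first level `t ≤ T` at which `x` is large is `l`, or `x` is not large up to level `T` and
`l` exceeds `T`. -/
def IsLevel (M : Market (Fin n) (Fin k) (Fin m)) (T : ℕ) (x : Fin m) (l : ℕ) : Prop :=
  1 ≤ l ∧ ∀ t, 1 ≤ t → t ≤ T → (l ≤ t ↔ M.IsLarge t x)

theorem spec_levelProg (hγ : 0 < M.gamma) {T : ℕ} (h₂ : σ.nat 2 = m) (h₃ : σ.nat 3 = 1)
    (h₅ : σ.nat 5 = T + 1) (hr₂ : σ.real 2 = 1) (hr₃ : σ.real 3 = (M.gamma : ℝ))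
    (hsize : ∀ x : Fin m, σ.realArr 0 x = M.size x) :
    Spec levelProg σ ((10 * T + 10) * m + 3) fun τ =>
      ∀ x : Fin m, IsLevel M T x (τ.natArr 6 x) := by
  refine (Spec.block_forLoop (s := 0) (c := 10 * T + 7) (fun j τ =>
      ∀ x : Fin m, (x : ℕ) < j → IsLevel M T x (τ.natArr 6 x))
    h₂ h₃ ?_ (Nat.zero_le _) (by decide) (by decide) (by decide) ?_ ?_
    (le_of_eq (by simp only [List.length_cons, List.length_nil, Nat.sub_zero]; ring))).mono
    le_rfl ?_
  · simp [applyAll, Instr.apply]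
  · simp
  · intro j τ _ hj hf hij hI
    have hx : τ.realArr 0 j = M.size ⟨j, hj⟩ := by
      rw [hf.realArr 0 (by decide)]; exact hsize ⟨j, hj⟩
    refine Spec.block_seq (N := 10 * T + 3) ?_ (by simp; omega)
    refine Spec.seq (N₁ := 10 * T + 1) (N₂ := 2) (Q' := fun ρ => IsLevel M T ⟨j, hj⟩ (ρ.nat 8))
      ?_ ?_ le_rfl
    · refine (Spec.forLoop (s := 1) (B := T + 1) (c := 7) (fun t ρ => 1 ≤ ρ.nat 8 ∧ ρ.nat 8 ≤ t ∧
          ∀ t', 1 ≤ t' → t' < t → (ρ.nat 8 ≤ t' ↔ M.IsLarge t' ⟨j, hj⟩))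
        ?_ ?_ ?_ (by omega) (by decide) (by decide) (by decide) ?_ ?_ (by omega)).mono le_rfl ?_
      · simpa [applyAll, Instr.apply, hf.nat 5 (by decide)] using h₅
      · simpa [applyAll, Instr.apply, hf.nat 3 (by decide)] using h₃
      · simp [applyAll, Instr.apply]
      · simp [applyAll, Instr.apply]
        intro t h₁ h₂
        omega
      · rintro t ρ ht hT hfρ hit ⟨h8, h8t, hlev⟩
        have hρ₁ : ρ.real 1 = M.size ⟨j, hj⟩ := by
          rw [hfρ.real 1 (by decide)]
          simp [applyAll, Instr.apply, hij, hx]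
        have hρ₂ : ρ.real 2 = 1 := by
          rw [hfρ.real 2 (by decide)]
          simp [applyAll, Instr.apply, hf.real 2 (by decide), hr₂]
        have hρ₃ : ρ.real 3 = (M.gamma : ℝ) := by
          rw [hfρ.real 3 (by decide)]
          simp [applyAll, Instr.apply, hf.real 3 (by decide), hr₃]
        have hone : ρ.nat 3 = 1 := by
          rw [hfρ.nat 3 (by decide)]
          simp [applyAll, Instr.apply, hf.nat 3 (by decide), h₃]
        have htest : 1 / ((t : ℝ) * (M.gamma : ℝ)) < M.size ⟨j, hj⟩ ↔ M.IsLarge t ⟨j, hj⟩ := Iff.rfl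
        refine Spec.block_seq (N := 3) (Spec.ite (fun hb => Spec.skip ?_ (by simp))
          fun hb => Spec.block ?_ (by simp)) (by simp)
        · simp only [applyAll, Instr.apply, Test.holds_rlt, Store.real_setReal, hit, hρ₁, hρ₂,
            hρ₃, if_true, Nat.reduceEqDiff, if_false, htest] at hb
          simp only [applyAll, Instr.apply, Store.nat_setNat, Store.nat_setReal, Nat.reduceEqDiff,
            if_false]
          refine ⟨h8, by omega, fun t' h₁ h₂ => ?_⟩
          rcases Nat.lt_succ_iff_lt_or_eq.1 h₂ with hlt | rfl
          · exact hlev t' h₁ hlt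
          · exact iff_of_true h8t hb
        · simp only [applyAll, Instr.apply, Test.holds_rlt, Store.real_setReal, hit, hρ₁, hρ₂,
            hρ₃, if_true, Nat.reduceEqDiff, if_false, htest] at hb
          simp only [applyAll, Instr.apply, Store.nat_setNat, Store.nat_setReal, Nat.reduceEqDiff,
            if_false, if_true, hit, hone]
          refine ⟨by omega, le_rfl, fun t' h₁ h₂ => iff_of_false (by omega) fun h => hb ?_⟩
          exact h.mono hγ h₁ (by omega)
      · rintro ρ - ⟨h8, -, hlev⟩
        exact ⟨h8, fun t h₁ h₂ => hlev t h₁ (by omega)⟩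
    · intro ρ hfρ hρ
      have h6 : ρ.nat 6 = j := by
        rw [hfρ.nat 6 (by decide)]
        simp [applyAll, Instr.apply, hij]
      have harr := hfρ.natArr 6 (by decide)
      refine Spec.block ?_ le_rfl
      intro x hxj
      simp only [applyAll, Instr.apply, Store.natArr_setNat, Store.natArr_setNatArr, h6, true_and,
        harr, Store.natArr_setReal]
      split_ifs with heq
      · obtain rfl : x = ⟨j, hj⟩ := Fin.ext heq
        exact hρ
      · exact hI x (by omega)
  · exact fun τ _ h x => h x x.2

end DAProgram

namespace Market

/-! ### One proposal, described explicitly -/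

section Step

variable {D : Type u} {H : Type v} {X : Type w} [Fintype D] [LinearOrder X] {M : Market D H X}

/-- If `v` is the first level whose bound is violated by a set one contract away from independence,
then independence is restored by the removal of any contract that is large at level `v`, and of no
other one. -/
theorem isIndep_erase_iff (hγ : 0 < M.gamma) {h : H} {I : Finset X} {x : X} (hI : M.IsIndep h I)
    (hx : M.hosp x = h) {v : ℕ} (hv₁ : 1 ≤ v) (hvD : v ≤ Fintype.card D)
    (hv : v < M.numLarge v (insert x I))
    (hmin : ∀ s, 1 ≤ s → s < v → M.numLarge s (insert x I) ≤ s) {b : X} (hb : b ∈ insert x I) :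
    M.IsIndep h ((insert x I).erase b) ↔ M.IsLarge v b := by
  constructor
  · intro h'
    by_contra hn
    have := (isIndep_iff.1 h').2 v hv₁ hvD
    rw [M.numLarge_erase_of_not_isLarge hn] at this
    omega
  · intro hl
    refine isIndep_iff.2 ⟨fun z hz => ?_, fun t h₁ h₂ => ?_⟩
    · rcases Finset.mem_insert.1 (Finset.mem_of_mem_erase hz) with rfl | hz
      · exact hx
      · exact hI.1 z hz
    · by_cases ht : t < v
      · exact (M.numLarge_mono t (Finset.erase_subset _ _)).trans (hmin t h₁ ht)
      · have h₃ := M.numLarge_erase_of_isLarge (hl.mono hγ hv₁ (not_lt.1 ht)) hb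
        have h₄ := M.numLarge_insert_le t x I
        have h₅ := (isIndep_iff.1 hI).2 t h₁ h₂
        omega

variable [DecidableEq H] [DecidableEq D] [Fintype X] {P : M.Profile} {hγ : 0 < M.gamma}
  {S : DAState H X}

/-- The next proposal of a free doctor is found at the position on her list that follows the number
of proposals she has made. -/
theorem RunInvariant.listPosition_eq_iff (hS : RunInvariant M hγ P S) {x : X}
    (hfree : ∀ y ∈ S.held, M.doc y ≠ M.doc x) :
    M.listPosition P x = (M.ofDoctor S.proposed (M.doc x)).card + 1 ↔
      x ∈ M.nextProposal P S (M.doc x) := by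
  classical
  have hmem : ∀ y, y ∈ Finset.univ.filter (fun y => P.Better y x) ↔ P.Better y x := by simp
  have hmem' : ∀ y, y ∈ M.ofDoctor S.proposed (M.doc x) ↔ y ∈ S.proposed ∧ M.doc y = M.doc x :=
    fun y => Finset.mem_filter
  have hpos : P.Acc x → M.listPosition P x =
      1 + (Finset.univ.filter fun y => P.Better y x).card := by
    intro h
    exact (if_pos h).trans (by congr!)
  constructor
  · intro heq
    have hacc : P.Acc x := by
      by_contra hn
      have h₀ : M.listPosition P x = 0 := if_neg hn
      omega
    rw [hpos hacc, add_comm, add_left_inj] at heq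
    have hxS : x ∉ S.proposed := by
      intro hxS
      refine heq.not_lt (Finset.card_lt_card ((Finset.ssubset_iff_of_subset fun y hy => ?_).2
        ⟨x, (hmem' x).2 ⟨hxS, rfl⟩, fun h => P.lists.irrefl x ((hmem x).1 h)⟩))
      have hy := (hmem y).1 hy
      exact (hmem' y).2 ⟨(Finset.mem_sdiff.1 ((hS.proposed x hxS).2 y hy)).1, hy.1⟩
    have hsub : M.ofDoctor S.proposed (M.doc x) ⊆ Finset.univ.filter fun y => P.Better y x := by
      intro y hy
      rw [hmem'] at hy
      refine (hmem y).2
        ((P.better_total hy.2 fun h => hxS (h ▸ hy.1)).resolve_right fun h => hxS ?_)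
      exact (Finset.mem_sdiff.1 ((hS.proposed y hy.1).2 x h)).1
    have hset := Finset.eq_of_subset_of_card_le hsub heq.le
    refine mem_nextProposal.2 ⟨rfl, hxS, hacc, fun y hyS hyd hne => ?_⟩
    refine (P.better_total hyd hne).resolve_left fun h => hyS ?_
    rw [← hmem, ← hset, hmem'] at h
    exact h.1
  · intro hx
    have hx' := mem_nextProposal.1 hx
    rw [hpos hx'.2.2.1, add_comm, add_left_inj]
    congr 1
    ext y
    rw [hmem, hmem']
    constructor
    · exact fun h => ⟨(Finset.mem_sdiff.1 (hS.mem_rejected hfree hx h)).1, h.1⟩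
    · rintro ⟨hyS, hyd⟩
      refine (P.better_total hyd fun h => hx'.2.1 (h ▸ hyS)).resolve_right fun h => hx'.2.1 ?_
      exact (Finset.mem_sdiff.1 ((hS.proposed y hyS).2 x h)).1

end Step

end Market

namespace DAProgram

open RealRAM Market

variable {n k m : ℕ} {M : Market (Fin n) (Fin k) (Fin m)} {P : M.Profile} {lev : Fin m → ℕ}
  {σ τ : Store}

/-! ### The main loop -/

/-- The store `σ` represents the state `S` of deferred acceptance. -/
structure Represents (M : Market (Fin n) (Fin k) (Fin m)) (σ : Store)
    (S : DAState (Fin k) (Fin m)) : Prop where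
  held : Holds σ S.held
  count : ∀ d : Fin n, σ.natArr 4 d = (M.ofDoctor S.proposed d).card
  busy : ∀ d : Fin n, σ.natArr 5 d = if ∃ y ∈ S.held, M.doc y = d then 1 else 0

theorem numLarge_eq {T : ℕ} (hlev : ∀ x, IsLevel M T x (lev x)) {t : ℕ} (h₁ : 1 ≤ t) (h₂ : t ≤ T)
    (Y : Finset (Fin m)) : M.numLarge t Y = (Y.filter fun x => lev x ≤ t).card := by
  classical
  unfold numLarge
  congr 1
  exact Finset.filter_congr fun x _ => ((hlev x).2 t h₁ h₂).symm

/-- The levels above the number of contracts impose no restrictions. -/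
theorem isIndep_of_forall_le_min {h : Fin k} {Y : Finset (Fin m)} (hY : ∀ x ∈ Y, M.hosp x = h)
    (hnum : ∀ t, 1 ≤ t → t ≤ min n m → M.numLarge t Y ≤ t) : M.IsIndep h Y := by
  refine isIndep_iff.2 ⟨hY, fun t h₁ h₂ => ?_⟩
  rw [Fintype.card_fin] at h₂
  by_cases htm : t ≤ m
  · exact hnum t h₁ (le_min h₂ htm)
  · have h₃ := M.numLarge_le_card t Y
    have h₄ := Finset.card_le_univ Y
    rw [Fintype.card_fin] at h₄
    omega

theorem isNext_iff {hγ : 0 < M.gamma} {S : DAState (Fin k) (Fin m)}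
    (hS : RunInvariant M hγ P S) (hR : Represents M σ S) (x : Fin m) :
    IsNext M P σ x ↔ (∀ y ∈ S.held, M.doc y ≠ M.doc x) ∧ x ∈ M.nextProposal P S (M.doc x) := by
  rw [IsNext, hR.count, hR.busy, and_comm]
  have : ((if ∃ y ∈ S.held, M.doc y = M.doc x then 1 else 0) = 0) ↔
      ∀ y ∈ S.held, M.doc y ≠ M.doc x := by
    simp
  rw [this]
  exact and_congr_right fun hfree => hS.listPosition_eq_iff hfree

theorem spec_acceptProg {T : ℕ} (hE : Env M P lev T σ) {S : DAState (Fin k) (Fin m)}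
    (hR : Represents M σ S) {x : Fin m} (h₁₄ : σ.nat 14 = x) (hxS : x ∉ S.proposed) :
    Spec acceptProg σ 8 fun τ => Represents M τ ⟨S.seq, insert x S.held, insert x S.proposed⟩ ∧
      τ.nat 15 = M.hosp x := by
  refine Spec.block ?_ (by simp)
  have hdoc := hE.doc x
  have hone := hE.nat_three
  refine ⟨⟨fun y => ?_, fun d => ?_, fun d => ?_⟩, ?_⟩
  · simp [applyAll, Instr.apply, h₁₄, hone, hR.held y, ← Fin.ext_iff]
    split_ifs <;> simp_all
  · simp [applyAll, Instr.apply, h₁₄, hdoc, hone, hR.count, ← Fin.ext_iff]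
    simp only [ofDoctor, Finset.filter_insert]
    split_ifs with h h' h'
    · rw [Finset.card_insert_of_notMem fun h => hxS (Finset.mem_filter.1 h).1, h]
    · exact absurd h.symm h'
    · exact absurd h'.symm h
    · rfl
  · simp [applyAll, Instr.apply, h₁₄, hdoc, hone, hR.busy, ← Fin.ext_iff]
    by_cases hd : d = M.doc x
    · simp [hd]
    · simp [hd, Ne.symm hd]
  · simp [applyAll, Instr.apply, h₁₄, hE.hosp]

theorem Represents.frame {S : DAState (Fin k) (Fin m)} (hR : Represents M σ S) {p : Prog}
    (hf : Frame p σ τ) (hp : ∀ a ∈ [3, 4, 5], a ∉ p.collect Instr.natArrWrites) :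
    Represents M τ S := by
  simp only [List.mem_cons, List.not_mem_nil, or_false, forall_eq_or_imp, forall_eq] at hp
  refine ⟨?_, ?_, ?_⟩
  · unfold Holds
    rw [hf.natArr 3 hp.1]
    exact hR.held
  · rw [hf.natArr 4 hp.2.1]
    exact hR.count
  · rw [hf.natArr 5 hp.2.2]
    exact hR.busy

theorem spec_discardProg {T : ℕ} (hE : Env M P lev T σ) {S : DAState (Fin k) (Fin m)}
    (hR : Represents M σ S) (hinj : Set.InjOn M.doc (S.held : Set (Fin m))) {a : Fin m}
    (h₁₉ : σ.nat 19 = a) (ha : a ∈ S.held) :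
    Spec discardProg σ 4 fun τ => Represents M τ ⟨S.seq, S.held.erase a, S.proposed⟩ := by
  refine Spec.block ?_ (by simp)
  have hdoc := hE.doc a
  have hzero := hE.nat_four
  refine ⟨fun y => ?_, fun d => ?_, fun d => ?_⟩
  · simp [applyAll, Instr.apply, h₁₉, hzero, hR.held y, ← Fin.ext_iff]
    split_ifs <;> simp_all
  · simp [applyAll, Instr.apply, h₁₉, hR.count]
  · simp [applyAll, Instr.apply, h₁₉, hdoc, hzero, hR.busy, ← Fin.ext_iff]
    split_ifs with h h' h' h''
    · -- The doctor of `a` holds no other contract.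
      obtain ⟨y, ⟨hya, hy⟩, hyd⟩ := h'
      exact absurd (hinj hy ha (hyd.trans h)) hya
    · rfl
    · rfl
    · obtain ⟨y, hy, hyd⟩ := h'
      exact absurd ⟨y, ⟨fun hya => h (hya ▸ hyd.symm), hy⟩, hyd⟩ h''
    · rename_i h''
      obtain ⟨y, ⟨_, hy⟩, hyd⟩ := h''
      exact absurd ⟨y, hy, hyd⟩ h'
    · rfl

theorem spec_proposeProg {hγ : 0 < M.gamma} (hE : Env M P lev (min n m) σ)
    (hlev : ∀ x, IsLevel M (min n m) x (lev x)) {S : DAState (Fin k) (Fin m)}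
    (hS : RunInvariant M hγ P S) (hR : Represents M σ S) {x : Fin m} (h₁₄ : σ.nat 14 = x)
    (hfree : ∀ y ∈ S.held, M.doc y ≠ M.doc x) (hx : x ∈ M.nextProposal P S (M.doc x)) :
    Spec proposeProg σ (50 * m + 50) fun τ =>
      Represents M τ (S.next M M.greedyChoice x) := by
  have hmin := min_le_right n m
  have hxS := (mem_nextProposal.1 hx).2.1
  set h := M.hosp x with hh
  set Y := M.ofHospital (insert x S.held) h with hY
  have hYeq : Y = insert x (M.ofHospital S.held h) := ofHospital_insert_self x S.held
  have hYh : ∀ y ∈ Y, M.hosp y = h := fun y hy => (Finset.mem_filter.1 hy).2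
  have hnum := fun {t} (h₁ : 1 ≤ t) (h₂ : t ≤ min n m) => numLarge_eq hlev h₁ h₂ Y
  refine Spec.seq (spec_acceptProg hE hR h₁₄ hxS) (N₂ := 50 * m + 42) ?_ (by omega)
  rintro σ₁ hf₁ ⟨hR₁, h₁₅⟩
  have hE₁ := hE.frame hf₁ (by decide)
  have hx₁ : σ₁.nat 14 = x := (hf₁.nat 14 (by decide)).trans h₁₄
  refine Spec.seq (spec_clearProg hE₁) (N₂ := 45 * m + 34) ?_ (by omega)
  intro σ₂ hf₂ hclear
  have hE₂ := hE₁.frame hf₂ (by decide)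
  have hR₂ := hR₁.frame hf₂ (by decide)
  refine Spec.seq (spec_countProg hE₂ hR₂.held ((hf₂.nat 15 (by decide)).trans h₁₅) hclear)
    (N₂ := 30 * m + 31) ?_ (by omega)
  intro σ₃ hf₃ hcount
  have hE₃ := hE₂.frame hf₃ (by decide)
  have hR₃ := hR₂.frame hf₃ (by decide)
  refine Spec.seq (spec_scanProg hE₃ (fun x => (hlev x).1) hcount) (N₂ := 20 * m + 11) ?_ (by omega)
  intro σ₄ hf₄ hscan
  have hE₄ := hE₃.frame hf₄ (by decide)
  have hR₄ := hR₃.frame hf₄ (by decide)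
  refine Spec.ite (fun hb => Spec.skip ?_ (by omega)) fun hb => ?_
  · rw [Test.holds_eq, hE₄.nat_four] at hb
    have hind : M.IsIndep h Y := by
      refine isIndep_of_forall_le_min hYh fun t h₁ h₂ => ?_
      rw [hnum h₁ h₂]
      rcases hscan with hs | hs
      · exact hs.2 t h₁ h₂
      · omega
    have hheld := hS.next_held_of_isIndep hind
    exact ⟨hheld ▸ hR₄.held, hR₄.count, hheld ▸ hR₄.busy⟩
  · rw [Test.holds_eq, hE₄.nat_four] at hb
    obtain ⟨hv₁, hvT, hv, hvmin⟩ := hscan.resolve_left fun hs => hb hs.1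
    generalize hveq : σ₄.nat 17 = v at hv₁ hvT hv hvmin hb
    rw [← hnum hv₁ hvT] at hv
    have hvmin' : ∀ s, 1 ≤ s → s < v → M.numLarge s Y ≤ s := fun s h₁ h₂ => by
      rw [hnum h₁ (by omega)]
      exact hvmin s h₁ h₂
    have hvn : v ≤ Fintype.card (Fin n) := by
      rw [Fintype.card_fin]
      omega
    have hdep : ¬ M.IsIndep h Y := fun hi => absurd ((isIndep_iff.1 hi).2 v hv₁ hvn) (not_le.2 hv)
    have hI := hS.isIndep h
    -- The bound at level `v` was respected before the proposal, so the new contract is large.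
    have hxv : lev x ≤ v := by
      rw [(hlev x).2 v hv₁ hvT]
      by_contra hn
      rw [hYeq, M.numLarge_insert_of_not_isLarge hn] at hv
      exact absurd ((isIndep_iff.1 hI).2 v hv₁ hvn) (not_le.2 hv)
    have h₁₅' : σ₄.nat 15 = h := by
      rw [hf₄.nat 15 (by decide), hf₃.nat 15 (by decide), hf₂.nat 15 (by decide), h₁₅]
    have h₁₄' : σ₄.nat 14 = x := by
      rw [hf₄.nat 14 (by decide), hf₃.nat 14 (by decide), hf₂.nat 14 (by decide), hx₁]
    refine Spec.seq (spec_selectProg hE₄ hR₄.held h₁₅' h₁₄' (Finset.mem_insert_self _ _) rfl hveq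
      hxv) (N₂ := 4) ?_ (by omega)
    rintro σ₅ hf₅ ⟨a, ⟨haA, hah, hav⟩, h₁₉, hamin⟩
    have herase : ∀ b ∈ Y, (M.IsIndep h (Y.erase b) ↔ lev b ≤ v) := by
      intro b hb
      rw [(hlev b).2 v hv₁ hvT]
      rw [hYeq] at hb hv hvmin' ⊢
      exact isIndep_erase_iff hγ hI rfl hv₁ hvn hv hvmin' hb
    have haY : a ∈ Y := Finset.mem_filter.2 ⟨haA, hah⟩
    have hdisc : M.IsDiscarded h Y a := by
      refine ⟨haY, (herase a haY).2 hav, fun b hb hbI => priority_le_iff.1 ?_⟩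
      exact hamin b (Finset.mem_filter.1 hb).1 (Finset.mem_filter.1 hb).2 ((herase b hb).1 hbI)
    have hheld := hS.next_held_of_isDiscarded hdep hdisc
    have hinj : Set.InjOn M.doc ((insert x S.held : Finset (Fin m)) : Set (Fin m)) := by
      rw [Finset.coe_insert, Set.injOn_insert fun hxh => hxS (hS.held_subset hxh)]
      refine ⟨hS.injOn, ?_⟩
      rintro ⟨y, hy, hyx⟩
      exact hfree y hy hyx
    refine (spec_discardProg (hE₄.frame hf₅ (by decide)) (hR₄.frame hf₅ (by decide)) hinj h₁₉
      haA).mono le_rfl fun σ₆ _ hR₆ => ?_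
    exact ⟨hheld ▸ hR₆.held, hR₆.count, hheld ▸ hR₆.busy⟩

/-- The bound on the number of steps allows for the `r` contracts not yet proposed, and for the last
iteration, which finds no next proposal. -/
theorem spec_mainLoop {hγ : 0 < M.gamma} (hlev : ∀ x, IsLevel M (min n m) x (lev x)) (r : ℕ)
    {S : DAState (Fin k) (Fin m)} (hr : m - S.proposed.card = r)
    (hE : Env M P lev (min n m) σ) (hS : RunInvariant M hγ P S) (hR : Represents M σ S)
    (h₉ : σ.nat 9 = 1) :
    Spec mainLoop σ ((65 * m + 60) * (r + 1) + 1) fun τ =>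
      ∃ S', Relation.ReflTransGen (M.DAStep M.greedyChoice P) S S' ∧
        (∀ d, ¬ M.IsActive P S' d) ∧ Holds τ S'.held := by
  induction r using Nat.strong_induction_on generalizing S σ with
  | _ r ih =>
    have hbody : Spec (.seq findProg (.ite (.eq 9 3) proposeProg .skip)) σ (65 * m + 59) fun τ =>
        (τ.nat 9 = 0 ∧ Represents M τ S ∧ ∀ x, ¬ IsNext M P σ x) ∨
        (τ.nat 9 = 1 ∧ ∃ x, IsNext M P σ x ∧ Represents M τ (S.next M M.greedyChoice x)) := by
      refine Spec.seq (spec_findProg hE) (N₂ := 50 * m + 51) ?_ (by omega)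
      intro τ hf hτ
      have hE' := hE.frame hf (by decide)
      have hR' := hR.frame hf (by decide)
      refine Spec.ite (fun hb => ?_) fun hb => Spec.skip ?_ (by omega)
      · rw [Test.holds_eq, hE'.nat_three] at hb
        obtain ⟨x, hx, hx'⟩ := (hτ.resolve_left fun h => by omega).2
        have hx'' := (isNext_iff hS hR x).1 hx
        refine (spec_proposeProg hE' hlev hS hR' hx' hx''.1 hx''.2).mono le_rfl fun ρ hf' hρ => ?_
        exact Or.inr ⟨(hf'.nat 9 (by decide)).trans hb, x, hx, hρ⟩
      · rw [Test.holds_eq, hE'.nat_three] at hb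
        have h := hτ.resolve_right fun h => hb h.1
        exact Or.inl ⟨h.1, hR', h.2⟩
    obtain ⟨τ, c, he, hc, hτ⟩ := hbody
    have hE' := hE.frame he.frame (by decide)
    have htest : (Test.eq 9 3).Holds σ := by rw [Test.holds_eq, h₉, hE.nat_three]
    rcases hτ with ⟨h₉', hR', hnone⟩ | ⟨h₉', x, hx, hR'⟩
    · refine ⟨τ, _, .loop_next htest he (.loop_done ?_), ?_, S, .refl, ?_, hR'.held⟩
      · rw [Test.holds_eq, h₉', hE'.nat_three]
        exact zero_ne_one
      · have : 65 * m + 60 ≤ (65 * m + 60) * (r + 1) := Nat.le_mul_of_pos_right _ (Nat.succ_pos r)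
        omega
      · refine not_isActive_iff.2 fun x hx => ?_
        by_contra hn
        push Not at hn
        exact hnone x ((isNext_iff hS hR x).2 ⟨hn, hx⟩)
    · have hx' := (isNext_iff hS hR x).1 hx
      have hstep : M.DAStep M.greedyChoice P S (S.next M M.greedyChoice x) :=
        daStep_iff.2 ⟨x, hx'.1, hx'.2, rfl⟩
      have h₁ := card_proposed_lt_of_daStep hstep
      have h₂ := Finset.card_le_univ (S.next M M.greedyChoice x).proposed
      rw [Fintype.card_fin] at h₂
      obtain ⟨ρ, c', he', hc', S', hS', hend, hρ⟩ :=
        ih (m - (S.next M M.greedyChoice x).proposed.card) (by omega) rfl hE' (hS.next hstep) hR'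
          h₉'
      refine ⟨ρ, _, .loop_next htest he he', ?_, S', .head hstep hS', hend, hρ⟩
      have h₃ : (65 * m + 60) * (m - (S.next M M.greedyChoice x).proposed.card + 1) ≤
          (65 * m + 60) * r := Nat.mul_le_mul_left _ (by omega)
      rw [Nat.mul_succ (65 * m + 60) r]
      omega

/-- The program implements deferred acceptance in quadratic time. -/
theorem spec_prog (M : Market (Fin n) (Fin k) (Fin m)) (P : M.Profile) (hn : 2 ≤ n) (hm : 0 < m)
    (hs : M.maxSize < 1) :
    Spec prog (M.input P) (400 * m ^ 2) fun τ =>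
      ∃ A, IsOutput τ A ∧ M.DAOutcome M.greedyChoice P A := by
  have hγ : 0 < M.gamma := M.gamma_pos (by rwa [Fintype.card_fin]) hs
  have hmin := min_le_right n m
  have hsq : m ≤ m ^ 2 := Nat.le_self_pow two_ne_zero m
  have hnat : ∀ x : Fin m, (M.input P).natArr 0 x = M.doc x ∧ (M.input P).natArr 1 x = M.hosp x ∧
      (M.input P).natArr 2 x = M.listPosition P x := fun x => by simp [input]
  have hreal : ∀ x : Fin m, (M.input P).realArr 0 x = M.size x ∧
      (M.input P).realArr 1 x = M.util x := fun x => by simp [input]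
  have hzero : ∀ a j, 3 ≤ a → (M.input P).natArr a j = 0 := fun a j ha => by
    simp only [input]
    split_ifs <;> omega
  refine Spec.seq (spec_boundProg (n := n) (m := m) rfl rfl) (N₂ := 390 * m ^ 2 + 2) ?_ (by omega)
  rintro σ₁ hf₁ ⟨h₁₃, h₁₅⟩
  refine Spec.seq (spec_maxProg (M := M) hm (hf₁.nat 2 (by decide)) h₁₃ (hf₁.real 0 (by decide)) ?_)
    (N₂ := 375 * m ^ 2 + 4) ?_ (by omega)
  · rw [hf₁.realArr 0 (by decide)]
    exact fun x => (hreal x).1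
  intro σ₂ hf₂ hσ₂
  refine Spec.seq (spec_gammaProg (n := n) (M := M) ?_ ?_ hσ₂) (N₂ := 366 * m ^ 2 + 4) ?_ (by omega)
  · rw [hf₂.nat 0 (by decide), hf₁.nat 0 (by decide)]
    rfl
  · rw [hf₂.nat 3 (by decide), h₁₃]
  rintro σ₃ hf₃ ⟨hr₂, hr₃⟩
  have h₃₃ : σ₃.nat 3 = 1 := by
    rw [hf₃.nat 3 (by decide), hf₂.nat 3 (by decide), h₁₃]
  have h₃₅ : σ₃.nat 5 = min n m + 1 := by
    rw [hf₃.nat 5 (by decide), hf₂.nat 5 (by decide), h₁₅]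
  have h₃₂ : σ₃.nat 2 = m := by
    rw [hf₃.nat 2 (by decide), hf₂.nat 2 (by decide), hf₁.nat 2 (by decide)]
    rfl
  have hlevcost : (10 * min n m + 10) * m + 3 ≤ 20 * m ^ 2 + 3 := by
    rw [sq, ← mul_assoc]
    exact Nat.add_le_add_right (Nat.mul_le_mul_right _ (by omega)) _
  refine Spec.seq ((spec_levelProg hγ h₃₂ h₃₃ h₃₅ hr₂ hr₃ ?_).mono hlevcost fun _ _ h => h)
    (N₂ := 340 * m ^ 2) ?_ (by omega)
  · rw [hf₃.realArr 0 (by decide), hf₂.realArr 0 (by decide), hf₁.realArr 0 (by decide)]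
    exact fun x => (hreal x).1
  intro σ₄ hf₄ hlev
  refine Spec.block_seq (N := 330 * m ^ 2) ?_ (by simp; omega)
  set σ₅ := applyAll [.const 9 1] σ₄ with hσ₅
  have hf₅ : Frame (block [.const 9 1]) σ₄ σ₅ := frame_block _ _
  have harr : ∀ a, a ≠ 6 → σ₅.natArr a = (M.input P).natArr a := by
    intro a ha
    rw [hf₅.natArr a (by simp [block, Prog.collect, Instr.natArrWrites]),
      hf₄.natArr a (by simp [levelProg, forLoop, block, Prog.collect, Instr.natArrWrites, ha]),
      hf₃.natArr a (by simp [gammaProg, block, Prog.collect, Instr.natArrWrites]),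
      hf₂.natArr a (by simp [maxProg, forLoop, block, Prog.collect, Instr.natArrWrites]),
      hf₁.natArr a (by simp [boundProg, block, Prog.collect, Instr.natArrWrites])]
  have hE : Env M P (fun x => σ₄.natArr 6 x) (min n m) σ₅ := by
    constructor
    · rw [hf₅.nat 2 (by decide), hf₄.nat 2 (by decide), h₃₂]
    · rw [hf₅.nat 3 (by decide), hf₄.nat 3 (by decide), h₃₃]
    · rw [hf₅.nat 4 (by decide), hf₄.nat 4 (by decide), hf₃.nat 4 (by decide),
        hf₂.nat 4 (by decide), hf₁.nat 4 (by decide)]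
      rfl
    · rw [hf₅.nat 5 (by decide), hf₄.nat 5 (by decide), h₃₅]
    · exact fun x => harr 0 (by decide) ▸ (hnat x).1
    · exact fun x => harr 1 (by decide) ▸ (hnat x).2.1
    · exact fun x => harr 2 (by decide) ▸ (hnat x).2.2
    · exact fun x => rfl
    · rw [hf₅.realArr 1 (by decide), hf₄.realArr 1 (by decide), hf₃.realArr 1 (by decide),
        hf₂.realArr 1 (by decide), hf₁.realArr 1 (by decide)]
      exact fun x => (hreal x).2
  have hR : Represents M σ₅ daStart := by
    refine ⟨fun x => ?_, fun d => ?_, fun d => ?_⟩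
    · rw [harr 3 (by decide), hzero 3 _ le_rfl]
      simp [daStart]
    · rw [harr 4 (by decide), hzero 4 _ (by decide)]
      simp [daStart, ofDoctor]
    · rw [harr 5 (by decide), hzero 5 _ (by decide)]
      simp [daStart]
  refine (spec_mainLoop hlev m (S := daStart) (by simp [daStart]) hE (runInvariant_daStart hγ) hR
    (by simp [hσ₅, applyAll, Instr.apply])).mono ?_ ?_
  · nlinarith
  · rintro τ - ⟨S, hS, hend, hτ⟩
    exact ⟨S.held, hτ, S, hS, hend, rfl⟩

end DAProgram

theorem theorem5 :
    (∀ (D : Type u) (H : Type v) (X : Type w) [Fintype D] [DecidableEq D] [Fintype H]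
      [DecidableEq H] [Fintype X] [LinearOrder X] [Nonempty X] (M : Market D H X),
      2 ≤ Fintype.card D → M.maxSize < 1 →
        M.StrategyProof M.greedyChoice ∧
        ∀ P : M.Profile,
          M.DATerminates M.greedyChoice P ∧
          (∃ A, M.DAOutcome M.greedyChoice P A) ∧
          ∀ A, M.DAOutcome M.greedyChoice P A → M.IsStable P (M.gamma : ℝ) A) ∧
    (∃ (prog : RealRAM.Prog) (C : ℕ), ∀ (n k m : ℕ) (M : Market (Fin n) (Fin k) (Fin m))
      (P : M.Profile), 2 ≤ n → 0 < m → M.maxSize < 1 →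
        ∃ (σ : RealRAM.Store) (steps : ℕ) (A : Finset (Fin m)),
          RealRAM.Exec prog (M.input P) σ steps ∧ steps ≤ C * m ^ 2 ∧
          Market.IsOutput σ A ∧ M.DAOutcome M.greedyChoice P A) := by
  refine ⟨fun D H X _ _ _ _ _ _ _ M hD hs => ⟨M.strategyProof_greedyChoice (M.gamma_pos hD hs),
    fun P => ⟨M.daTerminates _ P, M.exists_daOutcome _ P, fun A hA => hA.isStable hD hs⟩⟩,
    DAProgram.prog, 400, fun n k m M P hn hm hs => ?_⟩
  obtain ⟨σ, steps, he, hsteps, A, hA, hA'⟩ := DAProgram.spec_prog M P hn hm hs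
  exact ⟨σ, steps, A, he, hsteps, hA, hA'⟩
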